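/- Let $T$ be a finite tree with vertex set $V(T)$, and let $w^-,w^+:V(T)\to\mathbb{Z}_{\ge 0}$. For $U\subseteq V(T)$ and $w\in\{w^-,w^+\}$ let $w(U)=\sum_{u\in U}w(u)$. A nonempty set $S\subseteq V(T)$ is called *connected* if the induced subgraph $T[S]$ is connected, and $S$ is called *$(w^-,w^+)$-safe* in $T$ if $w^-(V(C))\ge w^+(V(D))$ for every component $C$ of $T[S]$ and every component $D$ of $T-S$ such that some vertex of $C$ is adjacent to some vertex of $D$. **Theorem.** There is an algorithm (a single program for a unit-cost random access machine with addition, truncated subtraction, comparisons and indirect addressing) and an absolute constant $c$ such that the following holds. Given any tree $T$ of order $n$ with vertices $0,\dots,n-1$ (as a list of its edges, in any order) and any two functions $w^-,w^+:V(T)\to\mathbb{Z}_{\ge 0}$, the algorithm determines a connected $(w^-,w^+)$-safe set in $T$ of minimum $w^-$-weight, and it does so within $c\,nW^4$ steps, that is, in $O(nW^4)$ time, for every positive integer $W$ such that $w^-(S)\le W$ for some connected $(w^-,w^+)$-safe set $S$ in $T$. (The number $W$ is not part of the input.) -/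

import Mathlib

/-! ### Weighted safe sets -/

/-- The `w`-weight of a set `U` of vertices: the sum of `w u` over all `u` in `U`. -/
noncomputable def setWeight {V : Type*} [Fintype V] (w : V → ℕ) (U : Set V) : ℕ :=
  open Classical in ∑ u ∈ Finset.univ.filter (fun u => u ∈ U), w u

/-- The vertex set, as a set of vertices of `G`, of a component of the subgraph of `G` induced
by `S`. -/
def componentVerts {V : Type*} {G : SimpleGraph V} {S : Set V}
    (C : (G.induce S).ConnectedComponent) : Set V :=
  Subtype.val '' C.supp

/-- `S` is a `(wm, wp)`-safe set in `G`: for every component `C` of `G[S]` and every component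
`D` of `G - S` that is adjacent to `C`, the `wm`-weight of `C` is at least the `wp`-weight of
`D`. -/
def IsSafeSet {V : Type*} [Fintype V] (G : SimpleGraph V) (wm wp : V → ℕ) (S : Set V) : Prop :=
  ∀ (C : (G.induce S).ConnectedComponent) (D : (G.induce Sᶜ).ConnectedComponent),
    (∃ u ∈ componentVerts C, ∃ v ∈ componentVerts D, G.Adj u v) →
      setWeight wp (componentVerts D) ≤ setWeight wm (componentVerts C)

/-- `S` is a connected `(wm, wp)`-safe set in `G`: it is safe and induces a connected (in
particular, nonempty) subgraph. -/
def IsConnectedSafeSet {V : Type*} [Fintype V] (G : SimpleGraph V) (wm wp : V → ℕ)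
    (S : Set V) : Prop :=
  (G.induce S).Connected ∧ IsSafeSet G wm wp S

/-- `S` is a connected `(wm, wp)`-safe set in `G` of minimum `wm`-weight. -/
def IsMinConnectedSafeSet {V : Type*} [Fintype V] (G : SimpleGraph V) (wm wp : V → ℕ)
    (S : Set V) : Prop :=
  IsConnectedSafeSet G wm wp S ∧
    ∀ S' : Set V, IsConnectedSafeSet G wm wp S' → setWeight wm S ≤ setWeight wm S'

/-! ### A unit-cost random access machine

Programs are structured (sequencing, branching, loops). The memory holds natural numbers, in
registers and in arrays. Registers and arrays are named by constants of the program, so a program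
uses only finitely many of each; the cells of an array are addressed by computed values
(indirect addressing). The arithmetic is addition and truncated subtraction only. Every
elementary operation (reading a constant or a cell, arithmetic operation, comparison, logical
connective, assignment, branching) costs one step. -/

namespace RAM

/-- A memory state. -/
structure State where
  reg : ℕ → ℕ
  arr : ℕ → ℕ → ℕ

/-- Arithmetic expressions; `get a e` reads the cell of array `a` whose index is the value
of `e`. -/
inductive Expr where
  | lit (k : ℕ)
  | reg (x : ℕ)
  | get (a : ℕ) (e : Expr)
  | add (e₁ e₂ : Expr)
  | sub (e₁ e₂ : Expr)

/-- The value of an expression. -/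
def Expr.eval (σ : State) : Expr → ℕ
  | .lit k => k
  | .reg x => σ.reg x
  | .get a e => σ.arr a (e.eval σ)
  | .add e₁ e₂ => e₁.eval σ + e₂.eval σ
  | .sub e₁ e₂ => e₁.eval σ - e₂.eval σ

/-- The number of steps spent on evaluating an expression. -/
def Expr.cost : Expr → ℕ
  | .lit _ => 1
  | .reg _ => 1
  | .get _ e => e.cost + 1
  | .add e₁ e₂ => e₁.cost + e₂.cost + 1
  | .sub e₁ e₂ => e₁.cost + e₂.cost + 1

/-- Tests. -/
inductive Test where
  | le (e₁ e₂ : Expr)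
  | eq (e₁ e₂ : Expr)
  | neg (b : Test)
  | and (b₁ b₂ : Test)

/-- The truth value of a test. -/
def Test.eval (σ : State) : Test → Bool
  | .le e₁ e₂ => decide (e₁.eval σ ≤ e₂.eval σ)
  | .eq e₁ e₂ => decide (e₁.eval σ = e₂.eval σ)
  | .neg b => !(b.eval σ)
  | .and b₁ b₂ => b₁.eval σ && b₂.eval σ

/-- The number of steps spent on evaluating a test. -/
def Test.cost : Test → ℕ
  | .le e₁ e₂ => e₁.cost + e₂.cost + 1
  | .eq e₁ e₂ => e₁.cost + e₂.cost + 1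
  | .neg b => b.cost + 1
  | .and b₁ b₂ => b₁.cost + b₂.cost + 1

/-- Programs. `assign x e` writes the value of `e` to register `x`; `store a i e` writes the value
of `e` to the cell of array `a` whose index is the value of `i`; `loop b p` is
"while `b` do `p`". -/
inductive Program where
  | nop
  | assign (x : ℕ) (e : Expr)
  | store (a : ℕ) (i e : Expr)
  | seq (p q : Program)
  | branch (b : Test) (p q : Program)
  | loop (b : Test) (p : Program)

/-- Write `k` to register `x`. -/
def State.setReg (σ : State) (x k : ℕ) : State :=
  { σ with reg := Function.update σ.reg x k }

/-- Write `k` to cell `i` of array `a`. -/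
def State.setArr (σ : State) (a i k : ℕ) : State :=
  { σ with arr := Function.update σ.arr a (Function.update (σ.arr a) i k) }

/-- `Exec p σ τ t`: started in state `σ`, the program `p` halts in state `τ` after exactly `t`
steps. -/
inductive Exec : Program → State → State → ℕ → Prop where
  | nop (σ : State) : Exec .nop σ σ 1
  | assign (σ : State) (x : ℕ) (e : Expr) :
      Exec (.assign x e) σ (σ.setReg x (e.eval σ)) (e.cost + 1)
  | store (σ : State) (a : ℕ) (i e : Expr) :
      Exec (.store a i e) σ (σ.setArr a (i.eval σ) (e.eval σ)) (i.cost + e.cost + 1)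
  | seq {p q : Program} {σ ρ τ : State} {s t : ℕ} :
      Exec p σ ρ s → Exec q ρ τ t → Exec (.seq p q) σ τ (s + t)
  | branch_true {b : Test} {p q : Program} {σ τ : State} {t : ℕ} :
      b.eval σ = true → Exec p σ τ t → Exec (.branch b p q) σ τ (b.cost + 1 + t)
  | branch_false {b : Test} {p q : Program} {σ τ : State} {t : ℕ} :
      b.eval σ = false → Exec q σ τ t → Exec (.branch b p q) σ τ (b.cost + 1 + t)
  | loop_done {b : Test} {p : Program} {σ : State} :
      b.eval σ = false → Exec (.loop b p) σ σ (b.cost + 1)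
  | loop_step {b : Test} {p : Program} {σ ρ τ : State} {s t : ℕ} :
      b.eval σ = true → Exec p σ ρ s → Exec (.loop b p) ρ τ t →
        Exec (.loop b p) σ τ (b.cost + 1 + s + t)

end RAM

/-! ### Input and output -/

/-- The list `E` contains every edge of `G` exactly once (in an arbitrary order, each edge in one
of its two orientations) and nothing else. -/
def ListsEdges {V : Type*} (G : SimpleGraph V) (E : List (V × V)) : Prop :=
  (E.map fun p => s(p.1, p.2)).Nodup ∧
    ∀ e : Sym2 V, e ∈ E.map (fun p => s(p.1, p.2)) ↔ e ∈ G.edgeSet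

/-- The initial memory for a graph with vertices `0, …, n - 1`, edge list `E` and weight functions
`wm`, `wp`: register `0` holds `n`, the arrays `0` and `1` hold `wm` and `wp`, the arrays `2` and
`3` hold the first and the second end-vertices of the edges in `E`, and all other cells are `0`. -/
def inputState (n : ℕ) (E : List (Fin n × Fin n)) (wm wp : Fin n → ℕ) : RAM.State where
  reg := fun x => if x = 0 then n else 0
  arr := fun a i =>
    match a with
    | 0 => if h : i < n then wm ⟨i, h⟩ else 0
    | 1 => if h : i < n then wp ⟨i, h⟩ else 0
    | 2 => if h : i < E.length then (E[i].1 : ℕ) else 0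
    | 3 => if h : i < E.length then (E[i].2 : ℕ) else 0
    | _ => 0

/-- The set of vertices that a final memory state describes: `v` belongs to it if and only if the
cell `v` of array `4` holds `1`. -/
def outputSet (n : ℕ) (τ : RAM.State) : Set (Fin n) :=
  {v | τ.arr 4 v = 1}

/-! ### A program logic for the random access machine -/

namespace RAM

/-! Root the tree. A connected set `S` has a unique highest vertex `u`, and every other vertex of
`S` has its parent in `S`. Hence `T - S` splits into the full subtrees below those vertices outside
`S` whose parent lies in `S`, together with the part not below `u`. So `S` is safe exactly when each
of these pieces has `wp`-weight at most `s = wm(S)`; this is `IsLocallySafe`, and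
`exists_isLocallySafe` and `IsLocallySafe.isConnectedSafeSet` give the two directions.

For fixed `s`, the existence of such a set of weight exactly `s` with top `u` is a knapsack problem
on the tree. Processing edges from the leaves upwards, each child is either cut off, which is
allowed when its subtree weighs at most `s`, or merged into its parent with some weight `b`.
`IsLocallySafe.dp_weight` shows that every admissible set is seen by this recursion, and `Recon`
turns a positive table entry back into a set by undoing the edges in reverse order.

The program tries `s = 0, 1, 2, …` and stops at the first success, so the weight found is minimum
and `W` need not be known. A round costs `O(n (s + 1)^2)`, because each of the `n - 1` edges
combines two rows of length `s + 1`; the size of the input weights plays no role. Summing over `s ≤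
W` gives `O(n W^3)` (`runs_main`), which is more than enough.

The rooting comes from stripping leaves in linear time (`runs_strip`): with the degree and the sum
of the names of the remaining neighbors of each vertex, the neighbor of a leaf can be read off
without adjacency lists. Multiplication is avoided by storing the column addresses `j * n`, each
obtained from its predecessor by one addition. -/

theorem Test.eval_le (e₁ e₂ : Expr) (σ : State) :
    (Test.le e₁ e₂).eval σ = true ↔ e₁.eval σ ≤ e₂.eval σ := decide_eq_true_iff

theorem Test.eval_eq (e₁ e₂ : Expr) (σ : State) :
    (Test.eq e₁ e₂).eval σ = true ↔ e₁.eval σ = e₂.eval σ := decide_eq_true_iff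

theorem Test.eval_neg (b : Test) (σ : State) :
    (Test.neg b).eval σ = true ↔ ¬ b.eval σ = true := by
  simp [Test.eval]

theorem Test.eval_and (b₁ b₂ : Test) (σ : State) :
    (Test.and b₁ b₂).eval σ = true ↔ b₁.eval σ = true ∧ b₂.eval σ = true := by
  simp [Test.eval]

/-- Whether the program contains an assignment to the register `r`. -/
def Program.modR : Program → ℕ → Bool
  | .nop, _ => false
  | .assign x _, r => x == r
  | .store _ _ _, _ => false
  | .seq p q, r => p.modR r || q.modR r
  | .branch _ p q, r => p.modR r || q.modR r
  | .loop _ p, r => p.modR r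

/-- Whether the program contains a write to the array `a`. -/
def Program.modA : Program → ℕ → Bool
  | .nop, _ => false
  | .assign _ _, _ => false
  | .store b _ _, a => b == a
  | .seq p q, a => p.modA a || q.modA a
  | .branch _ p q, a => p.modA a || q.modA a
  | .loop _ p, a => p.modA a

/-- `τ` agrees with `σ` on everything that `p` does not write to. -/
structure Frame (p : Program) (σ τ : State) : Prop where
  reg (r : ℕ) (h : p.modR r = false := by rfl) : τ.reg r = σ.reg r
  arr (a : ℕ) (h : p.modA a = false := by rfl) : τ.arr a = σ.arr a

theorem Frame.refl (p : Program) (σ : State) : Frame p σ σ :=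
  ⟨fun _ _ => rfl, fun _ _ => rfl⟩

theorem Frame.trans {p : Program} {σ ρ τ : State} (h₁ : Frame p σ ρ) (h₂ : Frame p ρ τ) :
    Frame p σ τ :=
  ⟨fun r h => (h₂.reg r h).trans (h₁.reg r h), fun a h => (h₂.arr a h).trans (h₁.arr a h)⟩

theorem Frame.mono {p q : Program} {σ τ : State} (h : Frame p σ τ)
    (hR : ∀ r, q.modR r = false → p.modR r = false)
    (hA : ∀ a, q.modA a = false → p.modA a = false) : Frame q σ τ :=
  ⟨fun r hr => h.reg r (hR r hr), fun a ha => h.arr a (hA a ha)⟩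

/-- Thanks to this, loop invariants need to mention only cells that the loop writes; everything else
is recovered by a syntactic check closed by `rfl`. -/
theorem Exec.frame {p : Program} {σ τ : State} {t : ℕ} (h : Exec p σ τ t) : Frame p σ τ := by
  induction h with
  | nop σ => exact Frame.refl _ _
  | assign σ x e =>
    refine ⟨fun r h => ?_, fun a h => rfl⟩
    have : r ≠ x := by simp [Program.modR] at h; exact fun e => h e.symm
    simp [State.setReg, this]
  | store σ a i e =>
    refine ⟨fun r h => rfl, fun b h => ?_⟩
    have : b ≠ a := by simp [Program.modA] at h; exact fun e => h e.symm
    simp [State.setArr, this]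
  | seq _ _ h₁ h₂ =>
    refine (h₁.mono ?_ ?_).trans (h₂.mono ?_ ?_) <;> simp +contextual [Program.modR, Program.modA]
  | branch_true _ _ h =>
    refine h.mono ?_ ?_ <;> simp +contextual [Program.modR, Program.modA]
  | branch_false _ _ h =>
    refine h.mono ?_ ?_ <;> simp +contextual [Program.modR, Program.modA]
  | loop_done _ => exact Frame.refl _ _
  | loop_step _ _ _ h₁ h₂ =>
    refine (h₁.mono ?_ ?_).trans h₂ <;> simp +contextual [Program.modR, Program.modA]

/-- Started in `σ`, the program `p` halts within `T` steps in a state satisfying `Q`. -/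
def Runs (p : Program) (σ : State) (T : ℕ) (Q : State → Prop) : Prop :=
  ∃ τ t, Exec p σ τ t ∧ t ≤ T ∧ Q τ

theorem Runs.mono {p : Program} {σ : State} {T T' : ℕ} {Q Q' : State → Prop}
    (h : Runs p σ T Q) (hT : T ≤ T') (hQ : ∀ τ, Frame p σ τ → Q τ → Q' τ) : Runs p σ T' Q' := by
  obtain ⟨τ, t, he, ht, hq⟩ := h
  exact ⟨τ, t, he, ht.trans hT, hQ τ he.frame hq⟩

theorem Runs.seq {p q : Program} {σ : State} {T₁ T₂ : ℕ} {Q₁ Q₂ : State → Prop}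
    (h₁ : Runs p σ T₁ Q₁) (h₂ : ∀ ρ, Frame p σ ρ → Q₁ ρ → Runs q ρ T₂ Q₂) :
    Runs (.seq p q) σ (T₁ + T₂) Q₂ := by
  obtain ⟨ρ, t, he, ht, hq⟩ := h₁
  obtain ⟨τ, t', he', ht', hq'⟩ := h₂ ρ he.frame hq
  exact ⟨τ, t + t', he.seq he', by omega, hq'⟩

/-- Each pass lowers `μ`, so there are at most `μ σ` passes, each paying for the test and the body;
the last summand pays for the final failing test. -/
theorem Runs.loop {b : Test} {p : Program} {T : ℕ} {I : State → Prop} {μ : State → ℕ}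
    (hstep : ∀ ρ, I ρ → b.eval ρ = true → Runs p ρ T fun τ => I τ ∧ μ τ < μ ρ)
    {σ : State} (h0 : I σ) :
    Runs (.loop b p) σ (μ σ * (b.cost + 1 + T) + (b.cost + 1))
      fun τ => I τ ∧ ¬ b.eval τ = true := by
  induction hm : μ σ using Nat.strong_induction_on generalizing σ with
  | _ m ih =>
    cases hb : b.eval σ with
    | false => exact ⟨σ, _, .loop_done hb, by omega, h0, by simp [hb]⟩
    | true =>
      obtain ⟨ρ, t, he, ht, hI, hμ⟩ := hstep σ h0 hb
      obtain ⟨τ, t', he', ht', hq'⟩ := ih (μ ρ) (hm ▸ hμ) hI rfl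
      refine ⟨τ, _, .loop_step hb he he', ?_, hq'⟩
      have : (μ ρ + 1) * (b.cost + 1 + T) ≤ m * (b.cost + 1 + T) :=
        Nat.mul_le_mul_right _ (by omega)
      rw [Nat.succ_mul] at this
      omega

/-- "for `x` from `0` to (the value of) `y - 1` do `p`". -/
def forTo (x y : ℕ) (p : Program) : Program :=
  .seq (.assign x (.lit 0))
    (.loop (.neg (.le (.reg y) (.reg x))) (.seq p (.assign x (.add (.reg x) (.lit 1)))))

/-- The frame supplied to the body is relative to the start of the whole loop, so facts about
untouched cells survive all passes without being part of `I`. -/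
theorem Runs.forTo {x y : ℕ} {p : Program} {σ : State} {N T : ℕ} (I : ℕ → State → Prop)
    (hN : σ.reg y = N) (h0 : I 0 (σ.setReg x 0))
    (hstep : ∀ k < N, ∀ ρ, Frame (forTo x y p) σ ρ → ρ.reg x = k → I k ρ →
      Runs p ρ T fun τ => I (k + 1) (τ.setReg x (k + 1)))
    (hx : p.modR x = false := by rfl) (hy : p.modR y = false := by rfl)
    (hxy : (x == y) = false := by rfl) :
    Runs (RAM.forTo x y p) σ (N * (T + 9) + 7) (I N) := by
  have hyx : y ≠ x := by rintro rfl; simp at hxy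
  have key := Runs.loop (b := .neg (.le (.reg y) (.reg x)))
    (p := .seq p (.assign x (.add (.reg x) (.lit 1)))) (T := T + 4)
    (I := fun ρ => Frame (RAM.forTo x y p) σ ρ ∧ ρ.reg x ≤ N ∧ I (ρ.reg x) ρ)
    (μ := fun ρ => N - ρ.reg x) ?_ (σ := σ.setReg x 0) ?_
  · obtain ⟨τ, t, he, ht, ⟨hF, hle, hI⟩, hb⟩ := key
    have hfin : τ.reg x = N := by
      simp only [Test.eval_neg, Test.eval_le, Expr.eval, not_not] at hb
      rw [hF.reg y (by simp [RAM.forTo, Program.modR, hy, hxy]), hN] at hb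
      omega
    refine ⟨τ, _, .seq (.assign σ x (.lit 0)) he, ?_, hfin ▸ hI⟩
    simp only [State.setReg, Function.update_self, Test.cost, Expr.cost, Nat.sub_zero] at ht ⊢
    have : N * (1 + 1 + 1 + 1 + 1 + (T + 4)) = N * (T + 9) := by ring
    omega
  · rintro ρ ⟨hF, hle, hI⟩ hb
    have hlt : ρ.reg x < N := by
      simp only [Test.eval_neg, Test.eval_le, Expr.eval] at hb
      rw [hF.reg y (by simp [RAM.forTo, Program.modR, hy, hxy]), hN] at hb
      omega
    obtain ⟨τ, t, he, ht, hQ⟩ := hstep _ hlt ρ hF rfl hI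
    have hxτ : τ.reg x = ρ.reg x := he.frame.reg x hx
    refine ⟨_, _, he.seq (.assign τ x _), ?_, ⟨?_, ?_, ?_⟩, ?_⟩
    · simp only [Expr.cost]; omega
    · refine hF.trans ((he.seq (.assign τ x _)).frame.mono ?_ ?_) <;>
        simp +contextual [RAM.forTo, Program.modR, Program.modA]
    · simp only [State.setReg, Expr.eval, Function.update_self]; omega
    · simpa only [State.setReg, Expr.eval, Function.update_self, hxτ] using hQ
    · simp only [State.setReg, Expr.eval, Function.update_self]; omega
  · refine ⟨⟨fun r h => ?_, fun a h => rfl⟩, by simp [State.setReg], by simpa [State.setReg] using h0⟩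
    have : r ≠ x := by
      simp [RAM.forTo, Program.modR] at h; exact fun e => h.1 e.symm
    simp [State.setReg, this]

/-- Programs without loops. -/
def Program.loopFree : Program → Bool
  | .nop => true
  | .assign _ _ => true
  | .store _ _ _ => true
  | .seq p q => p.loopFree && q.loopFree
  | .branch _ p q => p.loopFree && q.loopFree
  | .loop _ _ => false

/-- The final state of a loop-free program. -/
def Program.result : Program → State → State
  | .nop, σ => σ
  | .assign x e, σ => σ.setReg x (e.eval σ)
  | .store a i e, σ => σ.setArr a (i.eval σ) (e.eval σ)
  | .seq p q, σ => q.result (p.result σ)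
  | .branch b p q, σ => if b.eval σ = true then p.result σ else q.result σ
  | .loop _ _, σ => σ

/-- An upper bound on the running time of a loop-free program. -/
def Program.bound : Program → ℕ
  | .nop => 1
  | .assign _ e => e.cost + 1
  | .store _ i e => i.cost + e.cost + 1
  | .seq p q => p.bound + q.bound
  | .branch b p q => b.cost + 1 + (p.bound + q.bound)
  | .loop _ _ => 0

theorem exec_of_loopFree {p : Program} (h : p.loopFree = true) (σ : State) :
    ∃ t ≤ p.bound, Exec p σ (p.result σ) t := by
  induction p generalizing σ with
  | nop => exact ⟨_, le_rfl, .nop σ⟩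
  | assign x e => exact ⟨_, le_rfl, .assign σ x e⟩
  | store a i e => exact ⟨_, le_rfl, .store σ a i e⟩
  | seq p q hp hq =>
    simp only [Program.loopFree, Bool.and_eq_true] at h
    obtain ⟨t, ht, he⟩ := hp h.1 σ
    obtain ⟨t', ht', he'⟩ := hq h.2 (p.result σ)
    exact ⟨_, Nat.add_le_add ht ht', he.seq he'⟩
  | branch b p q hp hq =>
    simp only [Program.loopFree, Bool.and_eq_true] at h
    simp only [Program.bound, Program.result]
    cases hb : b.eval σ with
    | true =>
      obtain ⟨t, ht, he⟩ := hp h.1 σ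
      exact ⟨b.cost + 1 + t, by omega, by simpa [hb] using Exec.branch_true hb he⟩
    | false =>
      obtain ⟨t, ht, he⟩ := hq h.2 σ
      exact ⟨b.cost + 1 + t, by omega, by simpa [hb] using Exec.branch_false hb he⟩
  | loop b p _ => simp [Program.loopFree] at h

/-- Straight-line code is verified by symbolic execution: `result` is simplified, and the side
conditions, including the time bound, are decided by computation. -/
theorem Runs.loopFree {p : Program} {σ : State} {T : ℕ} {Q : State → Prop}
    (hQ : Q (p.result σ)) (hp : p.loopFree = true := by rfl)
    (hT : p.bound ≤ T := by decide) : Runs p σ T Q := by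
  obtain ⟨t, ht, he⟩ := exec_of_loopFree hp σ
  exact ⟨_, t, he, ht.trans hT, hQ⟩

end RAM

/-! ### Rooted trees and safe sets -/

/-- A rooted presentation of a graph: every vertex other than the root has a parent of larger
rank, the edges are the pairs consisting of a vertex and its parent, and `ord` lists the vertices
other than the root by rank. -/
structure Rooting {V : Type*} (G : SimpleGraph V) (m : ℕ) where
  root : V
  par : V → V
  rank : V → ℕ
  ord : ℕ → V
  rank_root : rank root = m
  rank_ord : ∀ i < m, rank (ord i) = i
  rank_lt : ∀ v, v ≠ root → rank v < m
  ord_rank : ∀ v, v ≠ root → ord (rank v) = v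
  lt_par : ∀ v, v ≠ root → rank v < rank (par v)
  adj_iff : ∀ a b, G.Adj a b ↔ (a ≠ root ∧ par a = b) ∨ (b ≠ root ∧ par b = a)

namespace Rooting

variable {V : Type*} {G : SimpleGraph V} {m : ℕ} (R : Rooting G m)

/-- `a` is a child of `b`. -/
def IsChild (a b : V) : Prop := a ≠ R.root ∧ R.par a = b

/-- `y` is a descendant of `x` (possibly `x` itself). -/
def Desc (x y : V) : Prop := Relation.ReflTransGen R.IsChild y x

theorem ord_ne_root {i : ℕ} (hi : i < m) : R.ord i ≠ R.root := by
  intro h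
  have := R.rank_ord i hi
  rw [h, R.rank_root] at this
  omega

theorem rank_le (v : V) : R.rank v ≤ m := by
  by_cases h : v = R.root
  · rw [h, R.rank_root]
  · exact (R.rank_lt v h).le

theorem eq_of_rank_eq {a b : V} (h : R.rank a = R.rank b) : a = b := by
  by_cases ha : a = R.root
  · by_cases hb : b = R.root
    · rw [ha, hb]
    · have := R.rank_lt b hb
      rw [← h, ha, R.rank_root] at this
      omega
  · by_cases hb : b = R.root
    · have := R.rank_lt a ha
      rw [h, hb, R.rank_root] at this
      omega
    · rw [← R.ord_rank a ha, ← R.ord_rank b hb, h]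

/-- Ranks strictly increase towards the root and are bounded by `m`, so `m - rank` decreases on
passing to the parent. -/
theorem up_induction {P : V → Prop} (h : ∀ v, (v ≠ R.root → P (R.par v)) → P v) (v : V) : P v := by
  induction hk : m - R.rank v using Nat.strong_induction_on generalizing v with
  | _ k ih =>
    refine h v fun hv => ih _ ?_ _ rfl
    have := R.lt_par v hv
    have := R.rank_lt v hv
    omega

theorem desc_refl (x : V) : R.Desc x x := .refl

theorem desc_of_par {x y : V} (hy : y ≠ R.root) (h : R.Desc x (R.par y)) : R.Desc x y :=
  .head ⟨hy, rfl⟩ h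

theorem desc_cases {x y : V} (h : R.Desc x y) : y = x ∨ (y ≠ R.root ∧ R.Desc x (R.par y)) := by
  rcases Relation.ReflTransGen.cases_head h with rfl | ⟨c, ⟨h1, rfl⟩, h2⟩
  · exact .inl rfl
  · exact .inr ⟨h1, h2⟩

theorem rank_le_of_desc {x y : V} (h : R.Desc x y) : R.rank y ≤ R.rank x := by
  induction h using Relation.ReflTransGen.head_induction_on with
  | refl => exact le_rfl
  | head h _ ih => exact (h.2 ▸ R.lt_par _ h.1).le.trans ih

theorem not_desc_par {x : V} (hx : x ≠ R.root) : ¬ R.Desc x (R.par x) := fun h =>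
  absurd (R.rank_le_of_desc h) (R.lt_par x hx).not_ge

/-- The edge from `x` to its parent is the only exit from the subtree of `x`; all separation
arguments below rest on this. -/
theorem adj_cross {x a b : V} (ha : R.Desc x a) (hb : ¬ R.Desc x b) (h : G.Adj a b) :
    a = x ∧ x ≠ R.root ∧ R.par x = b := by
  rcases (R.adj_iff a b).1 h with ⟨h1, rfl⟩ | ⟨h1, rfl⟩
  · rcases R.desc_cases ha with rfl | ⟨_, h2⟩
    · exact ⟨rfl, h1, rfl⟩
    · exact absurd h2 hb
  · exact absurd (R.desc_of_par h1 ha) hb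

/-- Parents are unique, so the ancestors of `y` form a chain, and two siblings on a chain coincide
by comparison of ranks. -/
theorem desc_siblings {x c c' y : V} (hc : R.IsChild c x) (hc' : R.IsChild c' x)
    (h : R.Desc c y) (h' : R.Desc c' y) : c = c' := by
  have aux : ∀ {a b : V}, R.IsChild a x → R.IsChild b x → R.Desc b a → a = b := by
    intro a b ha hb hd
    rcases R.desc_cases hd with h | ⟨_, h⟩
    · exact h
    · rw [ha.2] at h
      have h1 := R.rank_le_of_desc h
      have h2 := R.lt_par b hb.1
      rw [hb.2] at h2
      omega
  have hU : Relator.RightUnique R.IsChild := fun a b c h1 h2 => h1.2.symm.trans h2.2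
  rcases Relation.ReflTransGen.total_of_right_unique hU h h' with h | h
  · exact aux hc hc' h
  · exact (aux hc' hc h).symm

theorem desc_of_mem {S : Set V} {u : V} (h : ∀ x ∈ S, x ≠ u → x ≠ R.root ∧ R.par x ∈ S) :
    ∀ x ∈ S, R.Desc u x :=
  R.up_induction fun x ih hx => by
    by_cases hxu : x = u
    · exact hxu ▸ R.desc_refl _
    · obtain ⟨h1, h2⟩ := h x hx hxu
      exact R.desc_of_par h1 (ih h1 h2)

theorem adj_par {x : V} (hx : x ≠ R.root) : G.Adj x (R.par x) :=
  (R.adj_iff _ _).2 (.inl ⟨hx, rfl⟩)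

theorem rank_le_of_mem {S : Set V} {u : V} (h : ∀ x ∈ S, x ≠ u → x ≠ R.root ∧ R.par x ∈ S)
    {x : V} (hx : x ∈ S) : R.rank x ≤ R.rank u :=
  R.rank_le_of_desc (R.desc_of_mem h x hx)

/-- Climbing to parents stays in `X` and ends at `u`. This serves for a candidate set, for a
subtree, and for the complement of a subtree. -/
theorem reachable_of_closed {S X : Set V} (hXS : X ⊆ S) {u : V} (hu : u ∈ X)
    (h : ∀ x ∈ X, x ≠ u → x ≠ R.root ∧ R.par x ∈ X) :
    ∀ x (hx : x ∈ X), (G.induce S).Reachable ⟨x, hXS hx⟩ ⟨u, hXS hu⟩ :=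
  R.up_induction fun x ih hx => by
    by_cases hxu : x = u
    · subst hxu; exact .rfl
    · obtain ⟨h1, h2⟩ := h x hx hxu
      refine .trans (SimpleGraph.Adj.reachable ?_) (ih h1 h2)
      exact R.adj_par h1

variable [Fintype V]

/-- The weight of the set of all descendants of `x`. -/
noncomputable def subWeight (w : V → ℕ) (x : V) : ℕ := setWeight w {y | R.Desc x y}

open Classical in
theorem subWeight_eq (w : V → ℕ) (x : V) :
    R.subWeight w x = w x + ∑ c ∈ Finset.univ.filter (fun c => R.IsChild c x), R.subWeight w c := by
  have h : Finset.univ.filter (fun y => y ∈ {y | R.Desc x y}) =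
      {x} ∪ (Finset.univ.filter fun c => R.IsChild c x).biUnion
        fun c => Finset.univ.filter fun y => y ∈ {y | R.Desc c y} := by
    ext y
    simp only [Set.mem_ofPred_eq, Finset.mem_filter, Finset.mem_univ, true_and, Finset.mem_union,
      Finset.mem_singleton, Finset.mem_biUnion]
    constructor
    · intro h
      rcases Relation.ReflTransGen.cases_tail h with rfl | ⟨c, h1, h2⟩
      · exact .inl rfl
      · exact .inr ⟨c, h2, h1⟩
    · rintro (rfl | ⟨c, h1, h2⟩)
      · exact R.desc_refl _
      · exact Relation.ReflTransGen.tail h2 h1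
  unfold subWeight setWeight
  rw [h, Finset.sum_union, Finset.sum_singleton, Finset.sum_biUnion]
  · intro c hc c' hc' hne
    refine Finset.disjoint_left.2 fun y hy hy' => hne ?_
    simp only [Finset.coe_filter, Finset.mem_univ, true_and, Set.mem_ofPred_eq,
      Finset.mem_filter] at hc hc' hy hy'
    exact R.desc_siblings hc hc' hy hy'
  · simp only [Finset.disjoint_singleton_left, Finset.mem_biUnion, Finset.mem_filter,
      Finset.mem_univ, true_and, Set.mem_ofPred_eq, not_exists, not_and]
    intro c hc hd
    have h1 := R.rank_le_of_desc hd
    have h2 := R.lt_par c hc.1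
    rw [hc.2] at h2
    omega

end Rooting

/-! ### Weights of sets and components of induced subgraphs. -/

theorem setWeight_mono {V : Type*} [Fintype V] (w : V → ℕ) {A B : Set V} (h : A ⊆ B) :
    setWeight w A ≤ setWeight w B := by
  classical
  refine Finset.sum_le_sum_of_subset fun x hx => ?_
  simp only [Finset.mem_filter, Finset.mem_univ, true_and] at hx ⊢
  exact h hx

theorem setWeight_add_compl {V : Type*} [Fintype V] (w : V → ℕ) (A : Set V) :
    setWeight w A + setWeight w Aᶜ = ∑ v, w v := by
  classical
  unfold setWeight
  rw [← Finset.sum_filter_add_sum_filter_not Finset.univ (fun u => u ∈ A)]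
  simp only [Set.mem_compl_iff]

theorem mem_of_reachable_induce {V : Type*} {G : SimpleGraph V} {S X : Set V} {a b : S}
    (h : (G.induce S).Reachable a b) (ha : (a : V) ∈ X)
    (hX : ∀ x y, x ∈ S → y ∈ S → x ∈ X → G.Adj x y → y ∈ X) : (b : V) ∈ X := by
  rw [SimpleGraph.reachable_iff_reflTransGen] at h
  induction h with
  | refl => exact ha
  | tail _ hadj ih => exact hX _ _ (Subtype.mem _) (Subtype.mem _) ih hadj

theorem mem_componentVerts {V : Type*} {G : SimpleGraph V} {S : Set V}
    {C : (G.induce S).ConnectedComponent} {v : V} :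
    v ∈ componentVerts C ↔ ∃ h : v ∈ S, (G.induce S).connectedComponentMk ⟨v, h⟩ = C := by
  simp [componentVerts, SimpleGraph.ConnectedComponent.mem_supp_iff]

theorem componentVerts_subset {V : Type*} {G : SimpleGraph V} {S : Set V}
    (C : (G.induce S).ConnectedComponent) {X : Set V} {x : V} (hx : x ∈ componentVerts C)
    (hxX : x ∈ X) (hX : ∀ x y, x ∈ S → y ∈ S → x ∈ X → G.Adj x y → y ∈ X) :
    componentVerts C ⊆ X := by
  intro y hy
  obtain ⟨h, rfl⟩ := mem_componentVerts.1 hx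
  obtain ⟨h', he⟩ := mem_componentVerts.1 hy
  exact mem_of_reachable_induce (SimpleGraph.ConnectedComponent.exact he.symm) hxX hX

theorem componentVerts_of_connected {V : Type*} {G : SimpleGraph V} {S : Set V}
    (hS : (G.induce S).Connected) (C : (G.induce S).ConnectedComponent) :
    componentVerts C = S := by
  ext v
  rw [mem_componentVerts]
  refine ⟨fun h => h.1, fun h => ⟨h, ?_⟩⟩
  induction C using SimpleGraph.ConnectedComponent.ind with
  | _ w => exact SimpleGraph.ConnectedComponent.sound (hS.preconnected _ _)

namespace Rooting

variable {V : Type*} {G : SimpleGraph V} {m : ℕ} (R : Rooting G m) [Fintype V]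

/-- The set `S` has the highest vertex `u`, and removing it leaves only components of `w`-weight
at most `s`, expressed in terms of the rooting. -/
structure IsLocallySafe (w : V → ℕ) (S : Set V) (u : V) (s : ℕ) : Prop where
  mem : u ∈ S
  par_mem : ∀ x ∈ S, x ≠ u → x ≠ R.root ∧ R.par x ∈ S
  below : ∀ x, x ∉ S → x ≠ R.root → R.par x ∈ S → R.subWeight w x ≤ s
  above : setWeight w {y | ¬ R.Desc u y} ≤ s

/-- Upper bounds suffice here: a component of the complement that touches `S` cannot cross `S`, so
it is contained either in a cut-off subtree or in the part not below `u`. -/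
theorem IsLocallySafe.isConnectedSafeSet {wm wp : V → ℕ} {S : Set V} {u : V}
    (h : R.IsLocallySafe wp S u (setWeight wm S)) : IsConnectedSafeSet G wm wp S := by
  have hconn : (G.induce S).Connected := by
    have : Nonempty S := ⟨⟨u, h.mem⟩⟩
    refine ⟨fun a b => ?_⟩
    have := R.reachable_of_closed subset_rfl h.mem h.par_mem
    exact (this a a.2).trans (this b b.2).symm
  refine ⟨hconn, fun C D ⟨a, ha, d, hd, hadj⟩ => ?_⟩
  rw [componentVerts_of_connected hconn] at ha ⊢
  have hdS : d ∉ S := (mem_componentVerts.1 hd).1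
  rcases (R.adj_iff a d).1 hadj with ⟨h1, rfl⟩ | ⟨h1, rfl⟩
  · have hau : a = u := by
      by_contra hne
      exact hdS (h.par_mem a ha hne).2
    subst hau
    refine (setWeight_mono wp ?_).trans h.above
    refine componentVerts_subset D hd (R.not_desc_par h1) fun x y hx hy hxX hxy hyX => ?_
    obtain ⟨rfl, _⟩ := R.adj_cross hyX hxX hxy.symm
    exact hy ha
  · refine (setWeight_mono wp ?_).trans (h.below d hdS h1 ha)
    refine componentVerts_subset D hd (R.desc_refl d) fun x y hx hy hxX hxy => ?_
    by_contra hyX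
    obtain ⟨rfl, _, rfl⟩ := R.adj_cross hxX hyX hxy
    exact hy ha

/-- Take `u` of maximum rank in `S`. Each cut-off subtree, and the part not below `u` when nonempty,
is connected, avoids `S` and has a neighbor in `S`, so it lies in one component to which safety
applies. -/
theorem exists_isLocallySafe {wm wp : V → ℕ} {S : Set V} (h : IsConnectedSafeSet G wm wp S) :
    ∃ u, R.IsLocallySafe wp S u (setWeight wm S) := by
  obtain ⟨hconn, hsafe⟩ := h
  obtain ⟨⟨x₀, hx₀⟩⟩ := hconn.nonempty
  obtain ⟨u, hu, hmax⟩ := S.toFinite.exists_maximalFor R.rank S ⟨x₀, hx₀⟩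
  have hmax' : ∀ x ∈ S, R.rank x ≤ R.rank u := fun x hx => by
    by_contra hlt
    exact hlt (hmax hx (not_le.1 hlt).le)
  have hpar : ∀ x ∈ S, x ≠ u → x ≠ R.root ∧ R.par x ∈ S := by
    intro x hx hxu
    have hlt : R.rank x < R.rank u :=
      lt_of_le_of_ne (hmax' x hx) fun e => hxu (R.eq_of_rank_eq e)
    have hxr : x ≠ R.root := by
      rintro rfl
      rw [R.rank_root] at hlt
      exact absurd (R.rank_le u) hlt.not_ge
    refine ⟨hxr, ?_⟩
    by_contra hp
    -- If the parent of `x` were missing, a walk in `S` from `x` to `u` could not leave the subtree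
    -- of `x`, although `u` has larger rank than `x`.
    have : R.Desc x u := mem_of_reachable_induce (X := {y | R.Desc x y})
      (hconn.preconnected ⟨x, hx⟩ ⟨u, hu⟩) (R.desc_refl x) fun a b ha hb haX hab => by
        by_contra hbX
        obtain ⟨rfl, _, rfl⟩ := R.adj_cross haX hbX hab
        exact hp hb
    exact absurd (R.rank_le_of_desc this) hlt.not_ge
  have hdesc := R.desc_of_mem hpar
  have hcomp : ∀ X : Set V, X ⊆ Sᶜ → ∀ d (hd : d ∈ X), (∃ a ∈ S, G.Adj a d) →
      (∀ x (hx : x ∈ X), ∃ hxS : x ∈ Sᶜ, ∃ hdS : d ∈ Sᶜ,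
        (G.induce Sᶜ).Reachable ⟨x, hxS⟩ ⟨d, hdS⟩) → setWeight wp X ≤ setWeight wm S := by
    rintro X hX d hd ⟨a, ha, had⟩ hr
    have h1 := hsafe ((G.induce S).connectedComponentMk ⟨a, ha⟩)
      ((G.induce Sᶜ).connectedComponentMk ⟨d, hX hd⟩)
      ⟨a, mem_componentVerts.2 ⟨ha, rfl⟩, d, mem_componentVerts.2 ⟨hX hd, rfl⟩, had⟩
    rw [componentVerts_of_connected hconn] at h1
    refine (setWeight_mono wp fun x hx => ?_).trans h1
    obtain ⟨hxS, hdS, hreach⟩ := hr x hx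
    exact mem_componentVerts.2 ⟨hxS, SimpleGraph.ConnectedComponent.sound hreach⟩
  refine ⟨u, hu, hpar, fun x hxS hxr hxp => ?_, ?_⟩
  -- From a vertex of `S` below `x`, parents lead within `S` to `u` and cannot pass the missing
  -- vertex `x`. So `u` would lie below `x`, hence have smaller rank than the parent of `x`, which
  -- is in `S`.
  · have hX : {y | R.Desc x y} ⊆ Sᶜ := by
      intro y hy hyS
      have hall : ∀ y, R.Desc x y → y ∈ S → u ≠ y → R.Desc x u := by
        refine R.up_induction fun y ih hxy hyS huy => ?_
        obtain ⟨h1, h2⟩ := hpar y hyS huy.symm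
        rcases R.desc_cases hxy with rfl | ⟨_, h3⟩
        · exact absurd hyS hxS
        · by_cases hup : u = R.par y
          · exact hup ▸ h3
          · exact ih h1 h3 h2 hup
      have hxu : R.Desc x u := by
        by_cases huy : u = y
        · exact huy ▸ hy
        · exact hall y hy hyS huy
      have h1 := R.rank_le_of_desc hxu
      have h2 := R.lt_par x hxr
      have h3 := hmax' _ hxp
      omega
    refine hcomp _ hX x (R.desc_refl x) ⟨_, hxp, (R.adj_par hxr).symm⟩ fun y hy =>
      ⟨hX hy, hX (R.desc_refl x), ?_⟩
    exact R.reachable_of_closed hX (R.desc_refl x) (fun z hz hzx =>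
      (R.desc_cases hz).resolve_left hzx) y hy
  · by_cases hur : u = R.root
    · have : {y | ¬ R.Desc u y} = ∅ := by
        ext y
        simp only [Set.mem_ofPred_eq, Set.mem_empty_iff_false, iff_false, not_not]
        refine R.up_induction (P := fun y => R.Desc u y) (fun v ih => ?_) y
        by_cases hv : v = R.root
        · rw [hv, hur]; exact R.desc_refl _
        · exact R.desc_of_par hv (ih hv)
      rw [this]
      simp [setWeight]
    · have hX : {y | ¬ R.Desc u y} ⊆ Sᶜ := fun y hy hyS => hy (hdesc y hyS)
      have hroot : ¬ R.Desc u R.root := fun hd => by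
        rcases R.desc_cases hd with h | ⟨h, _⟩
        · exact hur h.symm
        · exact h rfl
      have hreach := R.reachable_of_closed hX hroot fun z hz hzr =>
        ⟨hzr, fun hd => hz (R.desc_of_par hzr hd)⟩
      refine hcomp _ hX (R.par u) (R.not_desc_par hur) ⟨u, hu, R.adj_par hur⟩ fun y hy =>
        ⟨hX hy, hX (R.not_desc_par hur), ?_⟩
      exact (hreach y hy).trans (hreach _ (R.not_desc_par hur)).symm

end Rooting

/-! ### The dynamic program -/

namespace Rooting

variable {V : Type*} {G : SimpleGraph V} {m : ℕ} (R : Rooting G m) [Fintype V]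

/-- `R.dp wm wp s i x j`: among the descendants of `x` that are connected to `x` by the first `i`
edges, some choice of a connected set containing `x` has `wm`-weight `j` and cuts off only
subtrees of `wp`-weight at most `s`. -/
def dp (wm wp : V → ℕ) (s : ℕ) : ℕ → V → ℕ → Prop
  | 0, x, j => wm x = j
  | i + 1, x, j =>
    (x = R.par (R.ord i) ∧ ((R.subWeight wp (R.ord i) ≤ s ∧ dp wm wp s i x j) ∨
      ∃ b ≤ j, dp wm wp s i (R.ord i) b ∧ dp wm wp s i x (j - b))) ∨
    (x ≠ R.par (R.ord i) ∧ dp wm wp s i x j)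

open Classical in
/-- The weight of the part of `S` that the first `i` edges connect to `x`. -/
noncomputable def partWeight (wm : V → ℕ) (S : Set V) : ℕ → V → ℕ
  | 0, x => wm x
  | i + 1, x => partWeight wm S i x +
      if x = R.par (R.ord i) ∧ R.ord i ∈ S then partWeight wm S i (R.ord i) else 0

variable {wm wp : V → ℕ} {s : ℕ}

/-- The set itself dictates the choice at each edge: keep the child if it is in `S`, otherwise cut
it off, which `below` permits. -/
theorem IsLocallySafe.dp_partWeight {S : Set V} {u : V} (h : R.IsLocallySafe wp S u s) :
    ∀ i ≤ m, ∀ x ∈ S, R.dp wm wp s i x (R.partWeight wm S i x) := by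
  intro i
  induction i with
  | zero => exact fun _ x _ => rfl
  | succ i ih =>
    intro hi x hx
    have ih := ih (by omega)
    by_cases hxp : x = R.par (R.ord i)
    · refine .inl ⟨hxp, ?_⟩
      by_cases hv : R.ord i ∈ S
      · refine .inr ⟨R.partWeight wm S i (R.ord i), ?_, ih _ hv, ?_⟩
        · simp only [partWeight, if_pos (And.intro hxp hv)]; omega
        · simpa only [partWeight, if_pos (And.intro hxp hv), Nat.add_sub_cancel] using ih x hx
      · refine .inl ⟨h.below _ hv (R.ord_ne_root hi) (hxp ▸ hx), ?_⟩
        simpa only [partWeight, hv, and_false, if_false, Nat.add_zero] using ih x hx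
    · refine .inr ⟨hxp, ?_⟩
      simpa only [partWeight, hxp, false_and, if_false, Nat.add_zero] using ih x hx

-- Merging the `i`-th vertex moves its weight to its parent, which is still active, so the total
-- over the active vertices of `S` is invariant. At stage `rank u` only `u` is active.
open Classical in
theorem IsLocallySafe.sum_partWeight {S : Set V} {u : V} (h : R.IsLocallySafe wp S u s) :
    ∀ i ≤ R.rank u, ∑ x ∈ Finset.univ.filter (fun x => x ∈ S ∧ i ≤ R.rank x),
      R.partWeight wm S i x = setWeight wm S := by
  intro i
  induction i with
  | zero => intro _; simp [partWeight, setWeight]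
  | succ i ih =>
    intro hi
    have him : i < m := lt_of_lt_of_le hi (R.rank_le u)
    rw [← ih (by omega)]
    simp only [partWeight, Finset.sum_add_distrib]
    by_cases hv : R.ord i ∈ S
    · have hne : R.ord i ≠ u := by
        intro e
        have := R.rank_ord i him
        rw [e] at this
        omega
      obtain ⟨h1, h2⟩ := h.par_mem _ hv hne
      have h3 := R.lt_par _ h1
      rw [R.rank_ord i him] at h3
      have e : Finset.univ.filter (fun x => x ∈ S ∧ i ≤ R.rank x) =
          insert (R.ord i) (Finset.univ.filter (fun x => x ∈ S ∧ i + 1 ≤ R.rank x)) := by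
        ext x
        simp only [Finset.mem_filter, Finset.mem_univ, true_and, Finset.mem_insert]
        constructor
        · rintro ⟨hx, hr⟩
          rcases hr.eq_or_lt with e | hr
          · exact .inl (R.eq_of_rank_eq (by rw [R.rank_ord i him, e]))
          · exact .inr ⟨hx, hr⟩
        · rintro (rfl | ⟨hx, hr⟩)
          · exact ⟨hv, (R.rank_ord i him).ge⟩
          · exact ⟨hx, by omega⟩
      rw [e, Finset.sum_insert (by simp [R.rank_ord i him]), Nat.add_comm]
      congr 1
      simp only [hv, and_true]
      rw [Finset.sum_ite_eq' (Finset.univ.filter fun x => x ∈ S ∧ i + 1 ≤ R.rank x)]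
      simp only [Finset.mem_filter, Finset.mem_univ, true_and]
      rw [if_pos ⟨h2, by omega⟩]
    · simp only [hv, and_false, if_false, Finset.sum_const_zero, Nat.add_zero]
      refine Finset.sum_congr (Finset.filter_congr fun x _ => and_congr_right fun hx =>
        ⟨fun h => by omega, fun hr => ?_⟩) fun _ _ => rfl
      rcases hr.eq_or_lt with e | hr
      · refine absurd hx ?_
        rw [R.eq_of_rank_eq (a := x) (b := R.ord i) (by rw [R.rank_ord i him, e])]
        exact hv
      · exact hr

omit [Fintype V] in
theorem partWeight_eq_of_rank_le (S : Set V) (u : V) {i : ℕ} (hi : R.rank u ≤ i) (him : i ≤ m) :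
    R.partWeight wm S i u = R.partWeight wm S (R.rank u) u := by
  induction i, hi using Nat.le_induction with
  | base => rfl
  | succ i hi ih =>
    rw [← ih (by omega), partWeight, if_neg, Nat.add_zero]
    rintro ⟨e, -⟩
    have := R.lt_par _ (R.ord_ne_root him)
    rw [← e, R.rank_ord i him] at this
    omega

theorem IsLocallySafe.dp_weight {S : Set V} {u : V} (h : R.IsLocallySafe wp S u s)
    (hs : setWeight wm S = s) : R.dp wm wp s m u s := by
  classical
  have h1 := IsLocallySafe.dp_partWeight R (wm := wm) h m le_rfl u h.mem
  have h2 := IsLocallySafe.sum_partWeight R (wm := wm) h _ le_rfl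
  have e : Finset.univ.filter (fun x => x ∈ S ∧ R.rank u ≤ R.rank x) = {u} := by
    ext x
    simp only [Finset.mem_filter, Finset.mem_univ, true_and, Finset.mem_singleton]
    constructor
    · rintro ⟨hx, hr⟩
      exact R.eq_of_rank_eq (le_antisymm (R.rank_le_of_mem h.par_mem hx) hr)
    · rintro rfl
      exact ⟨h.mem, le_rfl⟩
  rw [e, Finset.sum_singleton] at h2
  rwa [R.partWeight_eq_of_rank_le S u (R.rank_le u) le_rfl, h2, hs] at h1

/-- The state of the top-down reconstruction of a set of weight `s` from the dynamic program,
after all edges except the first `i` have been treated: `S` is the set of vertices chosen so far,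
and `rem x` is the weight still to be realized by `x` and its descendants. -/
structure Recon (wm wp : V → ℕ) (s : ℕ) (u : V) (i : ℕ) (S : Finset V) (rem : V → ℕ) : Prop where
  mem : u ∈ S
  rank_le : ∀ x ∈ S, R.rank x ≤ R.rank u
  par_mem : ∀ x ∈ S, x ≠ u → x ≠ R.root ∧ i ≤ R.rank x ∧ R.par x ∈ S
  below : ∀ x, x ∉ S → x ≠ R.root → i ≤ R.rank x → R.par x ∈ S → R.subWeight wp x ≤ s
  dp : ∀ x ∈ S, R.dp wm wp s i x (rem x)
  sum : ∑ x ∈ S, rem x = s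

namespace Recon

variable {R} {u : V}

theorem start {rem : V → ℕ} (hu : R.dp wm wp s m u s) (hrem : rem u = s) :
    R.Recon wm wp s u m {u} rem where
  mem := by simp
  rank_le := by simp
  par_mem := by simp +contextual
  below x _ hx hm := absurd hm (R.rank_lt x hx).not_ge
  dp := by simpa [hrem] using hu
  sum := by simpa using hrem

variable {i : ℕ} {S : Finset V} {rem : V → ℕ}

theorem rem_le (h : R.Recon wm wp s u i S rem) {x : V} (hx : x ∈ S) : rem x ≤ s :=
  (Finset.single_le_sum (fun _ _ => Nat.zero_le _) hx).trans_eq h.sum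

theorem dp_of_ne (h : R.Recon wm wp s u (i + 1) S rem) {x : V} (hx : x ∈ S)
    (hne : x ≠ R.par (R.ord i)) : R.dp wm wp s i x (rem x) := by
  rcases h.dp x hx with ⟨e, _⟩ | ⟨_, h⟩
  · exact absurd e hne
  · exact h

/-- Covers both ways of not adding the `i`-th vertex: its parent is not chosen, or its subtree is
light enough to be cut off. -/
theorem step_exclude (h : R.Recon wm wp s u (i + 1) S rem)
    (hp : R.par (R.ord i) ∈ S → R.subWeight wp (R.ord i) ≤ s ∧
      R.dp wm wp s i (R.par (R.ord i)) (rem (R.par (R.ord i)))) :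
    R.Recon wm wp s u i S rem where
  mem := h.mem
  rank_le := h.rank_le
  par_mem x hx hxu := by
    obtain ⟨h1, h2, h3⟩ := h.par_mem x hx hxu
    exact ⟨h1, by omega, h3⟩
  below x hx hxr hi hpx := by
    rcases hi.eq_or_lt with e | hi
    · rw [e, R.ord_rank x hxr] at hp
      exact (hp hpx).1
    · exact h.below x hx hxr hi hpx
  dp x hx := by
    by_cases hxp : x = R.par (R.ord i)
    · subst hxp
      exact (hp hx).2
    · exact h.dp_of_ne hx hxp
  sum := h.sum

theorem ord_not_mem (h : R.Recon wm wp s u (i + 1) S rem) (him : i < m)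
    (hp : R.par (R.ord i) ∈ S) : R.ord i ∉ S := by
  intro hv
  have h1 := h.rank_le _ hp
  have h2 := R.lt_par _ (R.ord_ne_root him)
  have h3 := R.rank_ord i him
  by_cases e : R.ord i = u
  · rw [e] at h1 h2
    omega
  · have := (h.par_mem _ hv e).2.1
    omega

/-- The parent's remaining weight is split between parent and child, so the total stays `s`. At
stage `0` every remaining weight is the vertex's own weight. -/
theorem step_include [DecidableEq V] (h : R.Recon wm wp s u (i + 1) S rem) (him : i < m)
    (hp : R.par (R.ord i) ∈ S) {b : ℕ} (hb : b ≤ rem (R.par (R.ord i)))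
    (hv : R.dp wm wp s i (R.ord i) b)
    (hpb : R.dp wm wp s i (R.par (R.ord i)) (rem (R.par (R.ord i)) - b)) :
    R.Recon wm wp s u i (insert (R.ord i) S)
      (Function.update (Function.update rem (R.ord i) b) (R.par (R.ord i))
        (rem (R.par (R.ord i)) - b)) := by
  have hvS := h.ord_not_mem him hp
  have hne : R.ord i ≠ R.par (R.ord i) := fun e => hvS (e ▸ hp)
  have hlt := R.lt_par _ (R.ord_ne_root him)
  have hro := R.rank_ord i him
  refine ⟨by simp [h.mem], ?_, ?_, ?_, ?_, ?_⟩
  · intro x hx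
    rcases Finset.mem_insert.1 hx with rfl | hx
    · exact hlt.le.trans (h.rank_le _ hp)
    · exact h.rank_le x hx
  · intro x hx hxu
    rcases Finset.mem_insert.1 hx with rfl | hx
    · exact ⟨R.ord_ne_root him, hro.ge, Finset.mem_insert_of_mem hp⟩
    · obtain ⟨h1, h2, h3⟩ := h.par_mem x hx hxu
      exact ⟨h1, by omega, Finset.mem_insert_of_mem h3⟩
  · intro x hx hxr hi hpx
    rw [Finset.mem_insert, not_or] at hx
    rcases hi.eq_or_lt with e | hi
    · exact absurd (by rw [e, R.ord_rank x hxr]) hx.1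
    -- Children of the new vertex have rank below `i`, so the new vertex creates no condition yet.
    · rcases Finset.mem_insert.1 hpx with e | hpx
      · have := R.lt_par x hxr
        rw [e] at this
        omega
      · exact h.below x hx.2 hxr hi hpx
  · intro x hx
    by_cases hxp : x = R.par (R.ord i)
    · subst hxp
      simpa using hpb
    · rw [Function.update_of_ne hxp]
      rcases Finset.mem_insert.1 hx with rfl | hx
      · simpa using hv
      · rw [Function.update_of_ne (by rintro rfl; exact hvS hx)]
        exact h.dp_of_ne hx hxp
  · rw [Finset.sum_insert hvS, Function.update_of_ne hne, Function.update_self,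
      Finset.sum_update_of_mem hp]
    have h1 := h.sum
    rw [← Finset.add_sum_erase _ _ hp, Finset.erase_eq] at h1
    have h2 : ∑ x ∈ S \ {R.par (R.ord i)}, Function.update rem (R.ord i) b x =
        ∑ x ∈ S \ {R.par (R.ord i)}, rem x :=
      Finset.sum_congr rfl fun x hx => Function.update_of_ne
        (by rintro rfl; exact hvS (Finset.mem_sdiff.1 hx).1) _ _
    omega

theorem setWeight_eq (h : R.Recon wm wp s u 0 S rem) : setWeight wm (S : Set V) = s := by
  classical
  rw [← h.sum, ← Finset.sum_congr rfl fun x hx => h.dp x hx, setWeight]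
  congr 1
  ext x
  simp

theorem isLocallySafe (h : R.Recon wm wp s u 0 S rem)
    (htop : setWeight wp {y | ¬ R.Desc u y} ≤ s) : R.IsLocallySafe wp (S : Set V) u s where
  mem := h.mem
  par_mem x hx hxu := by
    obtain ⟨h1, _, h3⟩ := h.par_mem x hx hxu
    exact ⟨h1, h3⟩
  below x hx hxr hp := h.below x hx hxr (Nat.zero_le _) hp
  above := htop

end Recon

end Rooting

/-! ### Stripping leaves from a tree -/

/-- Folding the leaf `v` onto its only neighbor `p` sends each edge to an edge or to the single
vertex `p`, and hence preserves reachability. -/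
theorem SimpleGraph.connected_induce_erase {V : Type*} [DecidableEq V] {G : SimpleGraph V}
    {S : Finset V} {v p : V} (hS : (G.induce (S : Set V)).Connected)
    (hp : p ∈ S) (hvp : G.Adj v p) (huniq : ∀ y ∈ S, G.Adj v y → y = p) :
    (G.induce ((S.erase v : Finset V) : Set V)).Connected := by
  have hpv : p ≠ v := hvp.ne'
  have hmem : ∀ x : (S : Set V), (if (x : V) = v then p else (x : V)) ∈
      ((S.erase v : Finset V) : Set V) := by
    intro x
    split_ifs with h
    · exact Finset.mem_coe.2 (Finset.mem_erase.2 ⟨hpv, hp⟩)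
    · exact Finset.mem_coe.2 (Finset.mem_erase.2 ⟨h, x.2⟩)
  have key : ∀ a b : (S : Set V), (G.induce (S : Set V)).Reachable a b →
      (G.induce ((S.erase v : Finset V) : Set V)).Reachable ⟨_, hmem a⟩ ⟨_, hmem b⟩ := by
    intro a b h
    rw [SimpleGraph.reachable_iff_reflTransGen] at h
    induction h with
    | refl => exact .rfl
    | @tail b c _ hadj ih =>
      refine ih.trans ?_
      have hadj : G.Adj b c := hadj
      by_cases hb : (b : V) = v
      · have hc : (c : V) = p := huniq c c.2 (hb ▸ hadj)
        simp only [hb, hc, if_true, hpv, if_false]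
        exact .rfl
      · by_cases hc : (c : V) = v
        · have hb' : (b : V) = p := huniq b b.2 (hc ▸ hadj.symm)
          simp only [hb', hc, if_true, hpv, if_false]
          exact .rfl
        · refine SimpleGraph.Adj.reachable ?_
          simpa [hb, hc] using hadj
  have : Nonempty ((S.erase v : Finset V) : Set V) :=
    ⟨⟨p, Finset.mem_coe.2 (Finset.mem_erase.2 ⟨hpv, hp⟩)⟩⟩
  refine ⟨fun a b => ?_⟩
  obtain ⟨ha, ha'⟩ := Finset.mem_erase.1 (Finset.mem_coe.1 a.2)
  obtain ⟨hb, hb'⟩ := Finset.mem_erase.1 (Finset.mem_coe.1 b.2)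
  have := key ⟨a, ha'⟩ ⟨b, hb'⟩ (hS.preconnected _ _)
  simpa [ha, hb] using this

/-- The set `S` remains after `k` vertices `o 0, …, o (k - 1)` have been removed from `G` one after
the other, each of them having a unique neighbor `q j` left when it was removed. -/
structure LeafStrip {V : Type*} [Fintype V] (G : SimpleGraph V) (S : Finset V) (k : ℕ)
    (o q : ℕ → V) : Prop where
  connected : (G.induce (S : Set V)).Connected
  card : S.card + k = Fintype.card V
  not_mem : ∀ v, v ∉ S ↔ ∃ j < k, o j = v
  inj : ∀ i < k, ∀ j < k, o i = o j → i = j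
  adj : ∀ j < k, G.Adj (o j) (q j)
  later : ∀ j < k, ∀ i ≤ j, q j ≠ o i
  eq_or : ∀ j < k, ∀ y, G.Adj (o j) y → y = q j ∨ ∃ i < j, o i = y

namespace LeafStrip

variable {V : Type*} [Fintype V] {G : SimpleGraph V} {S : Finset V} {k : ℕ} {o q : ℕ → V}

theorem start (hG : G.Connected) (o q : ℕ → V) : LeafStrip G Finset.univ 0 o q where
  connected := by
    rw [Finset.coe_univ]
    exact (SimpleGraph.induceUnivIso G).connected_iff.2 hG
  card := by simp
  not_mem := by simp
  inj := by simp
  adj := by simp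
  later := by simp
  eq_or := by simp

theorem step [DecidableEq V] (h : LeafStrip G S k o q) {v p : V} (hv : v ∈ S) (hp : p ∈ S)
    (hvp : G.Adj v p) (huniq : ∀ y ∈ S, G.Adj v y → y = p) :
    LeafStrip G (S.erase v) (k + 1) (Function.update o k v) (Function.update q k p) := by
  have ho : ∀ j < k, Function.update o k v j = o j := fun j hj =>
    Function.update_of_ne hj.ne _ _
  have hq : ∀ j < k, Function.update q k p j = q j := fun j hj =>
    Function.update_of_ne hj.ne _ _
  have hvo : ∀ j < k, o j ≠ v := fun j hj e => (h.not_mem v).2 ⟨j, hj, e⟩ hv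
  have hpo : ∀ j < k, o j ≠ p := fun j hj e => (h.not_mem p).2 ⟨j, hj, e⟩ hp
  refine ⟨SimpleGraph.connected_induce_erase h.connected hp hvp huniq, ?_, ?_, ?_, ?_, ?_, ?_⟩
  · have := Finset.card_erase_add_one hv
    have := h.card
    omega
  · intro x
    rw [Finset.mem_erase, not_and_or, not_not, h.not_mem x]
    constructor
    · rintro (rfl | ⟨j, hj, rfl⟩)
      · exact ⟨k, by omega, by simp⟩
      · exact ⟨j, by omega, ho j hj⟩
    · rintro ⟨j, hj, rfl⟩
      rcases Nat.lt_succ_iff_lt_or_eq.1 hj with hj | rfl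
      · exact .inr ⟨j, hj, (ho j hj).symm⟩
      · exact .inl (by simp)
  · intro i hi j hj
    rcases Nat.lt_succ_iff_lt_or_eq.1 hi with hi | rfl <;>
      rcases Nat.lt_succ_iff_lt_or_eq.1 hj with hj | rfl
    · rw [ho i hi, ho j hj]; exact h.inj i hi j hj
    · rw [ho i hi, Function.update_self]; exact fun e => absurd e (hvo i hi)
    · rw [ho j hj, Function.update_self]; exact fun e => absurd e.symm (hvo j hj)
    · exact fun _ => rfl
  · intro j hj
    rcases Nat.lt_succ_iff_lt_or_eq.1 hj with hj | rfl
    · rw [ho j hj, hq j hj]; exact h.adj j hj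
    · simpa using hvp
  · intro j hj i hi
    rcases Nat.lt_succ_iff_lt_or_eq.1 hj with hj | rfl
    · rw [hq j hj, ho i (by omega)]; exact h.later j hj i hi
    · rw [Function.update_self]
      rcases hi.lt_or_eq with hi | rfl
      · rw [ho i hi]; exact (hpo i hi).symm
      · rw [Function.update_self]; exact hvp.ne'
  · intro j hj y
    rcases Nat.lt_succ_iff_lt_or_eq.1 hj with hj | rfl
    · rw [hq j hj, ho j hj]
      intro hy
      rcases h.eq_or j hj y hy with e | ⟨i, hi, e⟩
      · exact .inl e
      · exact .inr ⟨i, hi, by rw [ho i (by omega), e]⟩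
    · rw [Function.update_self, Function.update_self]
      intro hy
      by_cases hyS : y ∈ S
      · exact .inl (huniq y hyS hy)
      · obtain ⟨i, hi, e⟩ := (h.not_mem y).1 hyS
        exact .inr ⟨i, hi, by rw [ho i hi, e]⟩

theorem card_eq_one [DecidableRel G.Adj] (h : LeafStrip G S k o q) (hG : G.IsAcyclic)
    (hdeg : ∀ x ∈ S, (S.filter (G.Adj x)).card ≠ 1) : S.card = 1 := by
  by_contra hne
  obtain ⟨⟨x₀, hx₀⟩⟩ := h.connected.nonempty
  have hpos : 0 < S.card := Finset.card_pos.2 ⟨x₀, hx₀⟩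
  have hnt : Nontrivial (S : Set V) :=
    Set.nontrivial_coe_sort.2 (Finset.one_lt_card_iff_nontrivial.1 (by omega))
  have hT : (G.induce (S : Set V)).IsTree := ⟨h.connected, hG.induce _⟩
  obtain ⟨⟨v, hv⟩, hvdeg⟩ := hT.exists_vert_degree_one_of_nontrivial
  obtain ⟨⟨p, hp⟩, hvp, hu⟩ := SimpleGraph.degree_eq_one_iff_existsUnique_adj.1 hvdeg
  refine hdeg v hv (Finset.card_eq_one.2 ⟨p, ?_⟩)
  ext y
  rw [Finset.mem_filter, Finset.mem_singleton]
  constructor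
  · rintro ⟨hy, hvy⟩
    exact congrArg Subtype.val (hu ⟨y, hy⟩ hvy)
  · rintro rfl
    exact ⟨hp, hvp⟩

/-- The survivor is the root, the rank is the time of removal, and the parent is the last remaining
neighbor. Of the two ends of an edge, the one removed first has the other as its parent. -/
theorem exists_rooting (h : LeafStrip G S k o q) (hS : S.card = 1) :
    ∃ R : Rooting G k, ∀ i < k, R.ord i = o i ∧ R.par (o i) = q i := by
  classical
  obtain ⟨r, rfl⟩ := Finset.card_eq_one.1 hS
  have hex : ∀ v, v ≠ r → ∃ j < k, o j = v := fun v hv =>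
    (h.not_mem v).1 (by simpa using hv)
  choose! f hfk hf using hex
  have hor : ∀ j < k, o j ≠ r := fun j hj e => by
    have := (h.not_mem r).2 ⟨j, hj, e⟩
    simp at this
  have hfo : ∀ j < k, f (o j) = j := fun j hj =>
    h.inj _ (hfk _ (hor j hj)) _ hj (hf _ (hor j hj))
  have hlt : ∀ v, v ≠ r → f v < (fun v => if v = r then k else f v) (q (f v)) := by
    intro v hv
    by_cases hq : q (f v) = r
    · simpa [hq] using hfk v hv
    · simp only [hq, if_false]
      by_contra hle
      exact h.later (f v) (hfk v hv) _ (not_lt.1 hle) (hf _ hq).symm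
  refine ⟨⟨r, fun v => q (f v), fun v => if v = r then k else f v, o, ?_, ?_, ?_, ?_, ?_, ?_⟩, ?_⟩
  · simp
  · intro i hi; simp [hor i hi, hfo i hi]
  · intro v hv; simpa [hv] using hfk v hv
  · intro v hv; simpa [hv] using hf v hv
  · intro v hv; simpa [hv] using hlt v hv
  · have aux : ∀ a b, G.Adj a b → a ≠ r → (b = r ∨ f a ≤ f b) → q (f a) = b := by
      intro a b hab ha hb
      have hadj : G.Adj (o (f a)) b := by rwa [hf a ha]
      rcases h.eq_or (f a) (hfk a ha) b hadj with e | ⟨i, hi, rfl⟩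
      · exact e.symm
      · have hik : i < k := hi.trans (hfk a ha)
        rcases hb with hb | hb
        · exact absurd hb (hor i hik)
        · rw [hfo i hik] at hb
          omega
    intro a b
    constructor
    · intro hab
      by_cases ha : a = r
      · have hb : b ≠ r := fun hb => hab.ne (ha.trans hb.symm)
        exact .inr ⟨hb, aux b a hab.symm hb (.inl ha)⟩
      · by_cases hb : b = r
        · exact .inl ⟨ha, aux a b hab ha (.inl hb)⟩
        · rcases le_total (f a) (f b) with hle | hle
          · exact .inl ⟨ha, aux a b hab ha (.inr hle)⟩
          · exact .inr ⟨hb, aux b a hab.symm hb (.inr hle)⟩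
    · have : ∀ a, a ≠ r → G.Adj a (q (f a)) := fun a ha => by
        simpa [hf a ha] using h.adj (f a) (hfk a ha)
      rintro (⟨ha, rfl⟩ | ⟨hb, rfl⟩)
      · exact this a ha
      · exact (this b hb).symm
  · exact fun i hi => ⟨rfl, by simp [hfo i hi]⟩

end LeafStrip

/-- A sum over all edges of a list that are incident with `x` is a sum over all neighbors
of `x`. -/
theorem ListsEdges.sum_incident {V : Type*} [Fintype V] [DecidableEq V] {G : SimpleGraph V}
    [DecidableRel G.Adj] {E : List (V × V)} (hE : ListsEdges G E) (x : V) (g : V → ℕ) :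
    (E.map fun e => (if e.1 = x then g e.2 else 0) + (if e.2 = x then g e.1 else 0)).sum =
      ∑ y ∈ Finset.univ.filter (G.Adj x), g y := by
  have key : ∀ E : List (V × V), (E.map fun p => s(p.1, p.2)).Nodup → (∀ e ∈ E, e.1 ≠ e.2) →
      (E.map fun e => (if e.1 = x then g e.2 else 0) + (if e.2 = x then g e.1 else 0)).sum =
        ∑ y ∈ Finset.univ.filter (fun y => s(x, y) ∈ E.map fun p => s(p.1, p.2)), g y := by
    intro E
    induction E with
    | nil => simp
    | cons e E ih =>
      intro hnd hne
      rw [List.map_cons, List.nodup_cons] at hnd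
      rw [List.map_cons, List.sum_cons, ih hnd.2 fun e he => hne e (List.mem_cons_of_mem _ he)]
      have hee := hne e List.mem_cons_self
      obtain ⟨a, b⟩ := e
      simp only at hee hnd ⊢
      have hins : ∀ z, s(x, z) = s(a, b) →
          Finset.univ.filter (fun y => s(x, y) ∈ (((a, b) :: E).map fun p => s(p.1, p.2))) =
            insert z (Finset.univ.filter fun y => s(x, y) ∈ (E.map fun p => s(p.1, p.2))) := by
        intro z hz
        ext y
        simp only [List.map_cons, List.mem_cons, Finset.mem_filter, Finset.mem_univ, true_and,
          Finset.mem_insert]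
        rw [← hz, Sym2.congr_right]
      have hnot : ∀ z, s(x, z) = s(a, b) →
          z ∉ Finset.univ.filter fun y => s(x, y) ∈ (E.map fun p => s(p.1, p.2)) := by
        intro z hz hmem
        rw [Finset.mem_filter, hz] at hmem
        exact hnd.1 hmem.2
      by_cases ha : a = x
      · have hb : b ≠ x := fun hb => hee (ha.trans hb.symm)
        rw [hins b (by rw [ha]), Finset.sum_insert (hnot b (by rw [ha]))]
        simp [ha, hb]
      · by_cases hb : b = x
        · have e : s(x, a) = s(a, b) := by rw [hb, Sym2.eq_swap]
          rw [hins a e, Finset.sum_insert (hnot a e)]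
          simp [ha, hb]
        · simp only [ha, hb, if_false, Nat.zero_add]
          refine Finset.sum_congr (Finset.filter_congr fun y _ => ?_) fun _ _ => rfl
          rw [List.map_cons, List.mem_cons]
          refine ⟨.inr, fun h => h.resolve_left fun h => ?_⟩
          rcases Sym2.eq_iff.1 h with ⟨h, _⟩ | ⟨h, _⟩
          · exact ha h.symm
          · exact hb h.symm
  rw [key E hE.1 fun e he hee => ?_]
  · refine Finset.sum_congr (Finset.filter_congr fun y _ => ?_) fun _ _ => rfl
    rw [hE.2, SimpleGraph.mem_edgeSet]
  · have := (hE.2 s(e.1, e.2)).1 (List.mem_map.2 ⟨e, he, rfl⟩)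
    rw [SimpleGraph.mem_edgeSet, hee] at this
    exact G.loopless.irrefl _ this

theorem ListsEdges.length_add_one {V : Type*} [Fintype V] {G : SimpleGraph V}
    {E : List (V × V)} (hE : ListsEdges G E) (hG : G.IsTree) :
    E.length + 1 = Fintype.card V := by
  classical
  rw [← hG.card_edgeFinset, ← List.length_map (f := fun p : V × V => s(p.1, p.2)),
    ← List.toFinset_card_of_nodup hE.1]
  congr 2
  ext e
  rw [List.mem_toFinset, hE.2, SimpleGraph.mem_edgeFinset]

/-! ### The program: computing an elimination order -/

namespace SafeSetProgram

open RAM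

/-- Add the edge with index `reg 3` to the degrees (array `5`) and the sums of the neighbors
(array `6`). -/
def addEdge : Program :=
  .seq (.assign 4 (.get 2 (.reg 3))) <|
  .seq (.assign 5 (.get 3 (.reg 3))) <|
  .seq (.store 5 (.reg 4) (.add (.get 5 (.reg 4)) (.lit 1))) <|
  .seq (.store 5 (.reg 5) (.add (.get 5 (.reg 5)) (.lit 1))) <|
  .seq (.store 6 (.reg 4) (.add (.get 6 (.reg 4)) (.reg 5)))
    (.store 6 (.reg 5) (.add (.get 6 (.reg 5)) (.reg 4)))

/-- Compute the number of edges (`reg 1`), the degrees, and the sums of the neighbors. -/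
def degrees : Program :=
  .seq (.assign 1 (.sub (.reg 0) (.lit 1))) (forTo 3 1 addEdge)

/-- If the vertex `reg 4` is a leaf, remove it and continue with its neighbor, otherwise continue
with the next vertex. -/
def stripStep : Program :=
  .branch (.eq (.get 5 (.reg 4)) (.lit 1))
    (.seq (.assign 5 (.get 6 (.reg 4))) <|
     .seq (.store 7 (.reg 6) (.reg 4)) <|
     .seq (.store 8 (.reg 6) (.reg 5)) <|
     .seq (.assign 6 (.add (.reg 6) (.lit 1))) <|
     .seq (.store 5 (.reg 4) (.lit 0)) <|
     .seq (.store 5 (.reg 5) (.sub (.get 5 (.reg 5)) (.lit 1))) <|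
     .seq (.store 6 (.reg 5) (.sub (.get 6 (.reg 5)) (.reg 4)))
      (.assign 4 (.reg 5)))
    (.seq (.assign 3 (.add (.reg 3) (.lit 1))) (.assign 4 (.reg 3)))

/-- Strip leaves; array `7` lists the removed vertices, and array `8` their parents. -/
def strip : Program :=
  .seq (.seq (.assign 3 (.lit 0)) (.seq (.assign 4 (.lit 0)) (.assign 6 (.lit 0))))
    (.loop (.neg (.le (.reg 0) (.reg 3))) stripStep)

/-! ### Correctness of the elimination order. -/

variable {n : ℕ} {T : SimpleGraph (Fin n)}

theorem runs_degrees [DecidableRel T.Adj] (hT : T.IsTree) {E : List (Fin n × Fin n)}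
    (hE : ListsEdges T E) (wm wp : Fin n → ℕ) :
    Runs degrees (inputState n E wm wp) (50 * n) fun τ => τ.reg 1 = n - 1 ∧
      ∀ x : Fin n, τ.arr 5 x = (Finset.univ.filter (T.Adj x)).card ∧
        τ.arr 6 x = ∑ y ∈ Finset.univ.filter (T.Adj x), (y : ℕ) := by
  have hlen : E.length + 1 = n := by simpa using hE.length_add_one hT
  have hne : ∀ e ∈ E, e.1 ≠ e.2 := by
    intro e he hee
    have := (hE.2 s(e.1, e.2)).1 (List.mem_map.2 ⟨e, he, rfl⟩)
    rw [SimpleGraph.mem_edgeSet, hee] at this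
    exact T.loopless.irrefl _ this
  have h1 : Runs (.assign 1 (.sub (.reg 0) (.lit 1))) (inputState n E wm wp) 4
      fun τ => τ = (inputState n E wm wp).setReg 1 (n - 1) := by
    refine Runs.loopFree ?_
    simp [Program.result, Expr.eval, inputState]
  refine (Runs.seq h1 (Q₂ := fun τ => τ.reg 1 = n - 1 ∧
      ∀ x : Fin n, τ.arr 5 x = (Finset.univ.filter (T.Adj x)).card ∧
        τ.arr 6 x = ∑ y ∈ Finset.univ.filter (T.Adj x), (y : ℕ)) (T₂ := (n - 1) * (34 + 9) + 7)
    ?_).mono (by omega) fun _ _ h => h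
  rintro ρ₀ - rfl
  refine (Runs.forTo (N := n - 1) (T := 34) (fun k ρ => ∀ x : Fin n,
    ρ.arr 5 x = ((E.take k).map fun e =>
      (if e.1 = x then 1 else 0) + (if e.2 = x then 1 else 0)).sum ∧
    ρ.arr 6 x = ((E.take k).map fun e =>
      (if e.1 = x then (e.2 : ℕ) else 0) + (if e.2 = x then (e.1 : ℕ) else 0)).sum)
    (by simp [State.setReg]) (by simp [State.setReg, inputState]) ?_).mono le_rfl ?_
  · intro k hk ρ hF h3 hI
    have hkE : k < E.length := by omega
    have ha2 : ρ.arr 2 k = (E[k].1 : ℕ) := by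
      rw [hF.arr 2]; simp [State.setReg, inputState, hkE]
    have ha3 : ρ.arr 3 k = (E[k].2 : ℕ) := by
      rw [hF.arr 3]; simp [State.setReg, inputState, hkE]
    refine Runs.loopFree (fun x => ?_)
    have hab : E[k].1 ≠ E[k].2 := hne _ (List.getElem_mem hkE)
    have hab' : (E[k].1 : ℕ) ≠ E[k].2 := fun h => hab (Fin.ext h)
    have hI' := hI x
    rw [List.take_succ_eq_append_getElem hkE, List.map_append, List.map_append, List.sum_append,
      List.sum_append, ← hI'.1, ← hI'.2]
    simp only [addEdge, Program.result, State.setReg, State.setArr, Expr.eval, h3, ha2, ha3,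
      Function.update_apply, List.map_cons, List.map_nil, List.sum_cons, List.sum_nil,
      Nat.reduceEqDiff, if_true, if_false, hab'.symm]
    by_cases hxa : E[k].1 = x
    · have hxb : E[k].2 ≠ x := fun h => hab (hxa.trans h.symm)
      subst hxa
      simp [hab', hxb]
    · by_cases hxb : E[k].2 = x
      · subst hxb
        simp [hxa]
      · have e1 : (x : ℕ) ≠ E[k].1 := fun h => hxa (Fin.ext h.symm)
        have e2 : (x : ℕ) ≠ E[k].2 := fun h => hxb (Fin.ext h.symm)
        simp [e1, e2, hxa, hxb]
  · intro τ hF hI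
    refine ⟨by rw [hF.reg 1]; simp [State.setReg], fun x => ?_⟩
    obtain ⟨h5, h6⟩ := hI x
    rw [List.take_of_length_le (by omega)] at h5 h6
    rw [h5, h6, hE.sum_incident x fun _ => 1, hE.sum_incident x fun y => (y : ℕ)]
    simp

/-- The memory while leaves are stripped. -/
structure Stripping (T : SimpleGraph (Fin n)) [DecidableRel T.Adj] (S : Finset (Fin n))
    (o q : ℕ → Fin n) (ρ : State) : Prop where
  strip : LeafStrip T S (ρ.reg 6) o q
  order : ∀ j < ρ.reg 6, ρ.arr 7 j = o j ∧ ρ.arr 8 j = q j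
  degree : ∀ x ∈ S, ρ.arr 5 x = (S.filter (T.Adj x)).card ∧
    ρ.arr 6 x = ∑ y ∈ S.filter (T.Adj x), (y : ℕ)
  removed : ∀ x : Fin n, x ∉ S → ρ.arr 5 x = 0
  le : ρ.reg 3 ≤ n
  lt : ρ.reg 3 < n → ρ.reg 4 < n
  eq : ρ.reg 3 = n → ρ.reg 4 = n
  -- The scan position is `reg 3`. Removing a leaf can create a leaf only at its neighbor, which
  -- becomes the current vertex `reg 4`, so the scan never has to go back.
  done : ∀ x : Fin n, (x : ℕ) ≤ ρ.reg 3 → (x : ℕ) ≠ ρ.reg 4 → ρ.arr 5 x ≠ 1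

/-- Every step either removes a vertex or advances the scan, whence the linear time bound. -/
theorem Stripping.step [DecidableRel T.Adj] {S : Finset (Fin n)} {o q : ℕ → Fin n} {ρ : State}
    (h : Stripping T S o q ρ) (h3 : ρ.reg 3 < n) :
    (∃ S o q, Stripping T S o q (stripStep.result ρ)) ∧
      (n - (stripStep.result ρ).reg 3) + (n - (stripStep.result ρ).reg 6) <
        (n - ρ.reg 3) + (n - ρ.reg 6) := by
  obtain ⟨v, hv⟩ : ∃ v : Fin n, ρ.reg 4 = v := ⟨⟨ρ.reg 4, h.lt h3⟩, rfl⟩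
  by_cases hd : ρ.arr 5 v = 1
  · have hvS : v ∈ S := by
      by_contra hvS
      rw [h.removed v hvS] at hd
      omega
    obtain ⟨hcard, hsum⟩ := h.degree v hvS
    obtain ⟨p, hp⟩ := Finset.card_eq_one.1 (hcard.symm.trans hd)
    rw [hp, Finset.sum_singleton] at hsum
    have hpm : p ∈ S ∧ T.Adj v p := by
      have : p ∈ S.filter (T.Adj v) := by rw [hp]; simp
      simpa using this
    have huniq : ∀ y ∈ S, T.Adj v y → y = p := fun y hy hvy => by
      have : y ∈ S.filter (T.Adj v) := by simp [hy, hvy]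
      simpa [hp] using this
    have hvp : v ≠ p := hpm.2.ne
    have hvp' : (v : ℕ) ≠ p := fun e => hvp (Fin.ext e)
    have hlt : ρ.reg 6 < n := by
      have := h.strip.card
      have := Finset.card_pos.2 ⟨v, hvS⟩
      simp only [Fintype.card_fin] at *
      omega
    have hr : stripStep.result ρ = (((((((ρ.setReg 5 p).setArr 7 (ρ.reg 6) v).setArr 8 (ρ.reg 6)
        p).setReg 6 (ρ.reg 6 + 1)).setArr 5 v 0).setArr 5 p (ρ.arr 5 p - 1)).setArr 6 p
        (ρ.arr 6 p - v)).setReg 4 p := by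
      simp only [stripStep, Program.result, Test.eval_eq, Expr.eval, hv, hd, if_true]
      simp [State.setReg, State.setArr, hv, hsum, hvp'.symm]
    have e3 : (stripStep.result ρ).reg 3 = ρ.reg 3 := by simp [hr, State.setReg, State.setArr]
    have e4 : (stripStep.result ρ).reg 4 = p := by simp [hr, State.setReg, State.setArr]
    have e6 : (stripStep.result ρ).reg 6 = ρ.reg 6 + 1 := by simp [hr, State.setReg, State.setArr]
    have a5 : (stripStep.result ρ).arr 5 =
        Function.update (Function.update (ρ.arr 5) v 0) p (ρ.arr 5 p - 1) := by
      simp [hr, State.setReg, State.setArr]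
    have a6 : (stripStep.result ρ).arr 6 = Function.update (ρ.arr 6) p (ρ.arr 6 p - v) := by
      simp [hr, State.setReg, State.setArr]
    have a7 : (stripStep.result ρ).arr 7 = Function.update (ρ.arr 7) (ρ.reg 6) v := by
      simp [hr, State.setReg, State.setArr]
    have a8 : (stripStep.result ρ).arr 8 = Function.update (ρ.arr 8) (ρ.reg 6) p := by
      simp [hr, State.setReg, State.setArr]
    generalize stripStep.result ρ = τ at *
    refine ⟨⟨S.erase v, Function.update o (ρ.reg 6) v, Function.update q (ρ.reg 6) p,
      ?_, ?_, ?_, ?_, ?_, ?_, ?_, ?_⟩, by omega⟩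
    · rw [e6]
      exact h.strip.step hvS hpm.1 hpm.2 huniq
    · intro j hj
      rw [e6] at hj
      rw [a7, a8]
      by_cases hj' : j = ρ.reg 6
      · subst hj'; simp
      · simpa [hj'] using h.order j (by omega)
    · intro x hx
      obtain ⟨hxv, hxS⟩ := Finset.mem_erase.1 hx
      have hxv' : (x : ℕ) ≠ v := fun e => hxv (Fin.ext e)
      rw [a5, a6, Finset.filter_erase]
      obtain ⟨hx5, hx6⟩ := h.degree x hxS
      by_cases hxp : x = p
      · subst hxp
        have hmem : v ∈ S.filter (T.Adj x) := by simp [hvS, hpm.2.symm]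
        rw [Function.update_self, Function.update_self, hx5, hx6, Finset.card_erase_of_mem hmem,
          ← Finset.add_sum_erase _ _ hmem]
        simp
      · have hxp' : (x : ℕ) ≠ p := fun e => hxp (Fin.ext e)
        have hnot : v ∉ S.filter (T.Adj x) := fun hmem =>
          hxp (huniq x hxS (Finset.mem_filter.1 hmem).2.symm)
        rw [Finset.erase_eq_of_notMem hnot, Function.update_of_ne hxp',
          Function.update_of_ne hxp', Function.update_of_ne hxv']
        exact ⟨hx5, hx6⟩
    · intro x hx
      rw [a5]
      by_cases hxv : x = v
      · subst hxv
        rw [Function.update_of_ne hvp', Function.update_self]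
      · have hxS : x ∉ S := fun hxS => hx (Finset.mem_erase.2 ⟨hxv, hxS⟩)
        have hxp : (x : ℕ) ≠ p := fun e => hxS (by rw [Fin.ext e]; exact hpm.1)
        have hxv' : (x : ℕ) ≠ v := fun e => hxv (Fin.ext e)
        rw [Function.update_of_ne hxp, Function.update_of_ne hxv', h.removed x hxS]
    · rw [e3]; exact h.le
    · intro _; rw [e4]; exact p.2
    · rw [e3]; omega
    · intro x hx hxp
      rw [e3] at hx
      rw [e4] at hxp
      rw [a5, Function.update_of_ne hxp]
      by_cases hxv : (x : ℕ) = v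
      · rw [hxv, Function.update_self]; omega
      · rw [Function.update_of_ne hxv]
        exact h.done x hx (by rwa [hv])
  · have hr : stripStep.result ρ = (ρ.setReg 3 (ρ.reg 3 + 1)).setReg 4 (ρ.reg 3 + 1) := by
      simp only [stripStep, Program.result, Test.eval_eq, Expr.eval, hv, hd, if_false]
      simp [State.setReg]
    have e3 : (stripStep.result ρ).reg 3 = ρ.reg 3 + 1 := by simp [hr, State.setReg]
    have e4 : (stripStep.result ρ).reg 4 = ρ.reg 3 + 1 := by simp [hr, State.setReg]
    have e6 : (stripStep.result ρ).reg 6 = ρ.reg 6 := by simp [hr, State.setReg]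
    have ea : (stripStep.result ρ).arr = ρ.arr := by simp [hr, State.setReg]
    generalize stripStep.result ρ = τ at *
    refine ⟨⟨S, o, q, ?_, ?_, ?_, ?_, ?_, ?_, ?_, ?_⟩, by omega⟩
    · rw [e6]; exact h.strip
    · rw [e6, ea]; exact h.order
    · rw [ea]; exact h.degree
    · rw [ea]; exact h.removed
    · omega
    · omega
    · omega
    · intro x hx hx4
      rw [ea]
      by_cases hxv : x = v
      · rw [hxv]; exact hd
      · exact h.done x (by omega) fun e => hxv (Fin.ext (e.trans hv))

theorem runs_strip [DecidableRel T.Adj] (hT : T.IsTree) {σ : State} (h0 : σ.reg 0 = n)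
    (hdeg : ∀ x : Fin n, σ.arr 5 x = (Finset.univ.filter (T.Adj x)).card ∧
        σ.arr 6 x = ∑ y ∈ Finset.univ.filter (T.Adj x), (y : ℕ)) :
    Runs strip σ (200 * n) fun τ => ∃ R : Rooting T (n - 1), ∀ i < n - 1,
      τ.arr 7 i = R.ord i ∧ τ.arr 8 i = R.par (R.ord i) := by
  obtain ⟨r⟩ := hT.connected.nonempty
  have hn : 0 < n := r.pos
  have h1 : Runs (.seq (.assign 3 (.lit 0)) (.seq (.assign 4 (.lit 0)) (.assign 6 (.lit 0)))) σ 6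
      fun τ => τ = ((σ.setReg 3 0).setReg 4 0).setReg 6 0 := Runs.loopFree rfl
  refine (Runs.seq h1 (T₂ := (n + n) * (5 + 45) + 5) (Q₂ := fun τ => ∃ R : Rooting T (n - 1),
      ∀ i < n - 1, τ.arr 7 i = R.ord i ∧ τ.arr 8 i = R.par (R.ord i)) ?_).mono (by omega)
      fun _ _ h => h
  rintro ρ₀ - rfl
  refine (Runs.loop (T := 45) (μ := fun ρ => (n - ρ.reg 3) + (n - ρ.reg 6))
    (I := fun ρ => ρ.reg 0 = n ∧ ∃ S o q, Stripping T S o q ρ) ?_ ⟨?_, ?_⟩).mono ?_ ?_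
  · rintro ρ ⟨hρ0, S, o, q, h⟩ hb
    simp only [Test.eval_neg, Test.eval_le, Expr.eval, hρ0, not_le] at hb
    obtain ⟨h1, h2⟩ := h.step hb
    refine (Runs.loopFree (T := 45) (Q := fun τ => τ = stripStep.result ρ) rfl).mono le_rfl ?_
    rintro τ hF rfl
    exact ⟨⟨(hF.reg 0).trans hρ0, h1⟩, h2⟩
  · simpa [State.setReg] using h0
  · refine ⟨Finset.univ, fun _ => r, fun _ => r, ?_, ?_, ?_, ?_, ?_, ?_, ?_, ?_⟩
    · simpa [State.setReg] using LeafStrip.start hT.connected _ _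
    · simp [State.setReg]
    · simpa [State.setReg] using hdeg
    · simp
    · simp [State.setReg]
    · simp [State.setReg]
    · simp only [State.setReg]; simp
    · intro x
      simp only [State.setReg]
      simp
      omega
  · simp [State.setReg, Test.cost, Expr.cost]
  · rintro τ - ⟨⟨hτ0, S, o, q, h⟩, hb⟩
    simp only [Test.eval_neg, Test.eval_le, Expr.eval, hτ0, not_not] at hb
    have h3 : τ.reg 3 = n := le_antisymm h.le hb
    have hS : S.card = 1 := h.strip.card_eq_one hT.isAcyclic fun x hx => by
      rw [← (h.degree x hx).1]
      -- After the scan `reg 4 = n` is not a vertex, so the exception in `done` is void and no leaf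
      -- is left.
      exact h.done x (by have := x.2; omega) (by rw [h.eq h3]; exact x.2.ne)
    have hk : τ.reg 6 = n - 1 := by
      have := h.strip.card
      simp only [Fintype.card_fin] at this
      omega
    obtain ⟨R, hR⟩ := h.strip.exists_rooting hS
    rw [← hk]
    refine ⟨R, fun i hi => ?_⟩
    obtain ⟨h1, h2⟩ := hR i hi
    rw [h1, h2]
    exact h.order i hi

end SafeSetProgram

/-! ### The program: the dynamic program and the reconstruction -/

namespace SafeSetProgram

open RAM

/-- Load the `i`-th removed vertex (`reg 4`) and its parent (`reg 5`), where `i` is the value of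
`reg 3`. -/
def load : Program :=
  .seq (.assign 4 (.get 7 (.reg 3))) (.assign 5 (.get 8 (.reg 3)))

/-- Compute the total weight (`reg 2`) and the weights of all subtrees (array `9`). -/
def subWeights : Program :=
  .seq (.assign 2 (.lit 0)) <|
  .seq (forTo 3 0
    (.seq (.store 9 (.reg 3) (.get 1 (.reg 3))) (.assign 2 (.add (.reg 2) (.get 1 (.reg 3))))))
    (forTo 3 1
      (.seq load (.store 9 (.reg 5) (.add (.get 9 (.reg 5)) (.get 9 (.reg 4))))))

/-- The address of the cell with row `x` and column `j` in a table. -/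
def cell (j x : Expr) : Expr := .add (.get 13 j) x

/-- Initialize the table of the dynamic program (array `10`). -/
def initTable : Program :=
  forTo 3 0 <| forTo 9 8 <|
    .branch (.eq (.get 0 (.reg 3)) (.reg 9))
      (.store 10 (cell (.reg 9) (.reg 3)) (.lit 1)) (.store 10 (cell (.reg 9) (.reg 3)) (.lit 0))

/-- Try to split the weight `reg 9` into `reg 10` for the child `reg 4` and the rest for the
parent `reg 5`. -/
def trySplit : Program :=
  .branch (.and (.eq (.get 10 (cell (.reg 10) (.reg 4))) (.lit 1))
      (.eq (.get 10 (cell (.sub (.reg 9) (.reg 10)) (.reg 5))) (.lit 1)))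
    (.seq (.assign 11 (.lit 1)) (.assign 12 (.add (.reg 10) (.lit 1)))) .nop

/-- Prepare the update of the cell for the parent `reg 5` and the weight `reg 9`, the largest
weight not yet treated. -/
def startCell : Program :=
  .seq (.assign 9 (.sub (.reg 7) (.reg 15))) <|
  .seq (.assign 16 (.add (.reg 9) (.lit 1))) <|
  .seq (.assign 11 (.lit 0)) <|
  .seq (.assign 12 (.lit 0))
    (.branch (.le (.get 9 (.reg 4)) (.reg 7))
      (.assign 11 (.get 10 (cell (.reg 9) (.reg 5)))) .nop)

/-- Write the new entry of the table and the choice that leads to it (array `11`). -/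
def writeCell : Program :=
  .seq (.store 10 (cell (.reg 9) (.reg 5)) (.reg 11))
    (.store 11 (cell (.reg 9) (.reg 4)) (.reg 12))

/-- Merge the table row of `reg 4` into that of its parent `reg 5`. -/
def mergeRow : Program :=
  forTo 15 8 (.seq startCell (.seq (forTo 10 16 trySplit) writeCell))

/-- Run the dynamic program. -/
def merge : Program := forTo 3 1 (.seq load mergeRow)

/-- Search for a highest vertex (`reg 14`) of a set of weight `reg 7`. -/
def search : Program :=
  forTo 3 0
    (.branch (.and (.eq (.get 10 (cell (.reg 7) (.reg 3))) (.lit 1))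
        (.le (.sub (.reg 2) (.get 9 (.reg 3))) (.reg 7)))
      (.seq (.assign 13 (.lit 1)) (.assign 14 (.reg 3))) .nop)

/-- Set up the next weight. -/
def nextWeight : Program :=
  .seq (.assign 7 (.reg 8)) <|
  .seq (.assign 8 (.add (.reg 8) (.lit 1)))
    (.store 13 (.reg 8) (.add (.get 13 (.reg 7)) (.reg 0)))

/-- Treat one weight. -/
def round : Program := .seq nextWeight (.seq initTable (.seq merge search))

/-- Undo one step of the dynamic program. -/
def undo : Program :=
  .seq (.assign 3 (.sub (.sub (.reg 1) (.lit 1)) (.reg 15))) <|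
  .seq load
    (.branch (.eq (.get 4 (.reg 5)) (.lit 1))
      (.seq (.assign 12 (.get 11 (cell (.get 12 (.reg 5)) (.reg 4))))
        (.branch (.le (.lit 1) (.reg 12))
          (.seq (.assign 12 (.sub (.reg 12) (.lit 1))) <|
           .seq (.store 4 (.reg 4) (.lit 1)) <|
           .seq (.store 12 (.reg 4) (.reg 12))
            (.store 12 (.reg 5) (.sub (.get 12 (.reg 5)) (.reg 12)))) .nop)) .nop)

/-- Reconstruct a set with highest vertex `reg 14` (array `4`). -/
def reconstruct : Program :=
  .seq (.seq (.store 4 (.reg 14) (.lit 1)) (.store 12 (.reg 14) (.reg 7))) (forTo 15 1 undo)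

/-- The whole program. -/
def main : Program :=
  .seq degrees <| .seq strip <| .seq subWeights <|
  .seq (.loop (.eq (.reg 13) (.lit 0)) round) reconstruct

/-! ### Correctness of the subtree weights and of the table. -/

variable {n : ℕ} {T : SimpleGraph (Fin n)}

theorem cell_eq_iff {x y : Fin n} {j k : ℕ} :
    j * n + (x : ℕ) = k * n + y ↔ j = k ∧ x = y := by
  refine ⟨fun h => ?_, fun ⟨h1, h2⟩ => by rw [h1, h2]⟩
  have hn : 0 < n := x.pos
  have h1 := congrArg (· / n) h
  have h2 := congrArg (· % n) h
  simp only [Nat.mul_comm _ n, Nat.mul_add_div hn, Nat.div_eq_of_lt x.2, Nat.div_eq_of_lt y.2,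
    Nat.mul_add_mod, Nat.mod_eq_of_lt x.2, Nat.mod_eq_of_lt y.2, Nat.add_zero] at h1 h2
  exact ⟨h1, Fin.ext h2⟩

/-- The memory before the search for a safe set starts. -/
structure Ready (R : Rooting T (n - 1)) (wm wp : Fin n → ℕ) (ρ : State) : Prop where
  order : ρ.reg 0 = n
  edges : ρ.reg 1 = n - 1
  total : ρ.reg 2 = ∑ x, wp x
  weight (x : Fin n) : ρ.arr 0 x = wm x
  sub (x : Fin n) : ρ.arr 9 x = R.subWeight wp x
  ord : ∀ i < n - 1, ρ.arr 7 i = R.ord i ∧ ρ.arr 8 i = R.par (R.ord i)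

theorem Ready.of_frame {R : Rooting T (n - 1)} {wm wp : Fin n → ℕ} {σ τ : State} {p : Program}
    (h : Ready R wm wp σ) (hF : Frame p σ τ) (h0 : p.modR 0 = false := by rfl)
    (h1 : p.modR 1 = false := by rfl) (h2 : p.modR 2 = false := by rfl)
    (a0 : p.modA 0 = false := by rfl) (a7 : p.modA 7 = false := by rfl)
    (a8 : p.modA 8 = false := by rfl) (a9 : p.modA 9 = false := by rfl) : Ready R wm wp τ := by
  refine ⟨?_, ?_, ?_, ?_, ?_, ?_⟩
  · rw [hF.reg 0 h0, h.order]
  · rw [hF.reg 1 h1, h.edges]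
  · rw [hF.reg 2 h2, h.total]
  · rw [hF.arr 0 a0]; exact h.weight
  · rw [hF.arr 9 a9]; exact h.sub
  · rw [hF.arr 7 a7, hF.arr 8 a8]; exact h.ord

theorem runs_subWeights (R : Rooting T (n - 1)) {wm wp : Fin n → ℕ} {σ : State} (hn : 0 < n)
    (h0 : σ.reg 0 = n) (h1 : σ.reg 1 = n - 1) (hwm : ∀ x : Fin n, σ.arr 0 x = wm x)
    (hwp : ∀ x : Fin n, σ.arr 1 x = wp x)
    (hord : ∀ i < n - 1, σ.arr 7 i = R.ord i ∧ σ.arr 8 i = R.par (R.ord i)) :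
    Runs subWeights σ (100 * n) (Ready R wm wp) := by
  classical
  have hA : Runs (.assign 2 (.lit 0)) σ 2 fun τ => τ = σ.setReg 2 0 := Runs.loopFree rfl
  refine (Runs.seq hA (T₂ := (n * (12 + 9) + 7) + ((n - 1) * (18 + 9) + 7)) (Q₂ := Ready R wm wp)
    ?_).mono (by omega) fun _ _ h => h
  rintro ρ₁ - rfl
  refine Runs.seq (Runs.forTo (N := n) (T := 12) (fun k ρ =>
    ρ.reg 2 = ∑ i ∈ Finset.range k, σ.arr 1 i ∧ ∀ x : Fin n, (x : ℕ) < k → ρ.arr 9 x = wp x)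
    (by simpa [State.setReg] using h0) (by simp [State.setReg]) ?_) ?_
  · intro k hk ρ hF h3 ⟨hI2, hI9⟩
    have a1 : ρ.arr 1 = σ.arr 1 := (hF.arr 1).trans rfl
    refine Runs.loopFree ⟨?_, fun x hx => ?_⟩
    · simp [Program.result, State.setReg, State.setArr, Expr.eval, Finset.sum_range_succ, h3, hI2,
        a1]
    · simp only [Program.result, State.setReg, State.setArr, Expr.eval, h3, a1,
        Function.update_self]
      by_cases hxk : (x : ℕ) = k
      · rw [hxk, Function.update_self, ← hxk]; exact hwp x
      · rw [Function.update_of_ne hxk]; exact hI9 x (by omega)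
  · intro ρ₂ hF₂ ⟨hI2, hI9⟩
    have r0 : ρ₂.reg 0 = n := (hF₂.reg 0).trans h0
    have r1 : ρ₂.reg 1 = n - 1 := (hF₂.reg 1).trans h1
    have a0 : ρ₂.arr 0 = σ.arr 0 := (hF₂.arr 0).trans rfl
    have a7 : ρ₂.arr 7 = σ.arr 7 := (hF₂.arr 7).trans rfl
    have a8 : ρ₂.arr 8 = σ.arr 8 := (hF₂.arr 8).trans rfl
    refine (Runs.forTo (N := n - 1) (T := 18) (fun k ρ => ∀ x : Fin n, ρ.arr 9 x =
      wp x + ∑ c ∈ Finset.univ.filter (fun c => R.IsChild c x ∧ R.rank c < k), R.subWeight wp c)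
      r1 ?_ ?_).mono le_rfl ?_
    · intro x
      simpa [State.setReg] using hI9 x x.2
    · intro k hk ρ hF h3 hI
      obtain ⟨ho, hp⟩ := hord k hk
      have hrk := R.rank_ord k hk
      -- All children of the `k`-th vertex have rank below `k`, so its entry is already final.
      have hv : ρ.arr 9 (R.ord k) = R.subWeight wp (R.ord k) := by
        rw [hI, R.subWeight_eq]
        congr 2
        refine Finset.filter_congr fun c _ => ⟨fun h => h.1, fun h => ⟨h, ?_⟩⟩
        have := R.lt_par c h.1
        rw [h.2] at this
        omega
      refine Runs.loopFree fun x => ?_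
      have e7 : ρ.arr 7 k = R.ord k := by rw [hF.arr 7, a7, ho]
      have e8 : ρ.arr 8 k = R.par (R.ord k) := by rw [hF.arr 8, a8, hp]
      have hres : ((Program.seq load (.store 9 (.reg 5) (.add (.get 9 (.reg 5))
          (.get 9 (.reg 4))))).result ρ).arr 9 = Function.update (ρ.arr 9) (R.par (R.ord k))
          (ρ.arr 9 (R.par (R.ord k)) + ρ.arr 9 (R.ord k)) := by
        simp [load, Program.result, State.setReg, State.setArr, Expr.eval, h3, e7, e8]
      change ((Program.seq load (.store 9 (.reg 5) (.add (.get 9 (.reg 5))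
          (.get 9 (.reg 4))))).result ρ).arr 9 x = _
      rw [hres, hv]
      by_cases hx : x = R.par (R.ord k)
      · subst hx
        rw [Function.update_self, hI, Nat.add_assoc]
        congr 1
        have e : Finset.univ.filter (fun c => R.IsChild c (R.par (R.ord k)) ∧ R.rank c < k + 1) =
            insert (R.ord k)
              (Finset.univ.filter fun c => R.IsChild c (R.par (R.ord k)) ∧ R.rank c < k) := by
          ext c
          simp only [Finset.mem_filter, Finset.mem_univ, true_and, Finset.mem_insert]
          constructor
          · rintro ⟨hc, hr⟩
            rcases Nat.lt_succ_iff_lt_or_eq.1 hr with hr | hr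
            · exact .inr ⟨hc, hr⟩
            · exact .inl (R.eq_of_rank_eq (hr.trans hrk.symm))
          · rintro (rfl | ⟨hc, hr⟩)
            · exact ⟨⟨R.ord_ne_root hk, rfl⟩, by omega⟩
            · exact ⟨hc, by omega⟩
        rw [e, Finset.sum_insert (by simp [hrk]), Nat.add_comm]
      · rw [Function.update_of_ne (fun e => hx (Fin.ext e)), hI]
        congr 2
        refine Finset.filter_congr fun c _ => and_congr_right fun hc => ⟨fun h => by omega, ?_⟩
        intro hr
        rcases Nat.lt_succ_iff_lt_or_eq.1 hr with hr | hr
        · exact hr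
        · refine absurd hc.2.symm ?_
          rw [R.eq_of_rank_eq (hr.trans hrk.symm)]
          exact hx
    · intro τ hF hI
      refine ⟨(hF.reg 0).trans r0, (hF.reg 1).trans r1, ?_, ?_, fun x => ?_, ?_⟩
      · rw [hF.reg 2, hI2, Finset.sum_range]
        exact Finset.sum_congr rfl fun x _ => hwp x
      · rw [hF.arr 0, a0]; exact hwm
      · rw [hI, R.subWeight_eq]
        congr 2
        refine Finset.filter_congr fun c _ => ⟨fun h => h.1, fun h => ⟨h, R.rank_lt c h.1⟩⟩
      · rw [hF.arr 7, hF.arr 8, a7, a8]; exact hord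

/-- The addresses of the table columns. -/
def Columns (n s : ℕ) (ρ : State) : Prop := ∀ j ≤ s, ρ.arr 13 j = j * n

/-- The entries `1` in the first `s + 1` columns of the table describe the predicate `P`. -/
def Table (s : ℕ) (P : Fin n → ℕ → Prop) (ρ : State) : Prop :=
  ∀ (x : Fin n) (j : ℕ), j ≤ s → (ρ.arr 10 (j * n + x) = 1 ↔ P x j)

theorem runs_initTable {wm : Fin n → ℕ} {σ : State} {s : ℕ} (h0 : σ.reg 0 = n)
    (h8 : σ.reg 8 = s + 1) (hwm : ∀ x : Fin n, σ.arr 0 x = wm x) (hC : Columns n s σ) :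
    Runs initTable σ (n * ((s + 1) * (24 + 9) + 7 + 9) + 7) (Table s fun x j => wm x = j) := by
  refine (Runs.forTo (N := n) (fun k ρ => ∀ (x : Fin n) (j : ℕ), (x : ℕ) < k → j ≤ s →
    (ρ.arr 10 (j * n + x) = 1 ↔ wm x = j)) h0 (by simp) ?_).mono le_rfl
    fun τ _ h x j hj => h x j x.2 hj
  intro k hk ρ hF h3 hI
  have r8 : ρ.reg 8 = s + 1 := (hF.reg 8).trans h8
  have a0 : ρ.arr 0 = σ.arr 0 := hF.arr 0
  have a13 : ρ.arr 13 = σ.arr 13 := hF.arr 13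
  refine (Runs.forTo (N := s + 1) (T := 24) (fun l ρ => ∀ (x : Fin n) (j : ℕ),
    ((x : ℕ) < k ∨ (x : ℕ) = k ∧ j < l) → j ≤ s → (ρ.arr 10 (j * n + x) = 1 ↔ wm x = j))
    r8 ?_ ?_).mono le_rfl ?_
  · intro x j hx hj
    simpa [State.setReg] using hI x j (by omega) hj
  · intro l hl ρ' hF' h9 hI'
    have r3 : ρ'.reg 3 = k := (hF'.reg 3).trans h3
    have b0 : ρ'.arr 0 k = wm ⟨k, hk⟩ := by rw [hF'.arr 0, a0]; exact hwm ⟨k, hk⟩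
    have b13 : ρ'.arr 13 l = l * n := by rw [hF'.arr 13, a13]; exact hC l (by omega)
    refine Runs.loopFree (Q := fun τ => ∀ (x : Fin n) (j : ℕ),
      ((x : ℕ) < k ∨ (x : ℕ) = k ∧ j < l + 1) → j ≤ s →
        ((τ.setReg 9 (l + 1)).arr 10 (j * n + x) = 1 ↔ wm x = j)) ?_
    intro x j hx hj
    have hres : (Program.result (.branch (.eq (.get 0 (.reg 3)) (.reg 9))
        (.store 10 (cell (.reg 9) (.reg 3)) (.lit 1))
        (.store 10 (cell (.reg 9) (.reg 3)) (.lit 0))) ρ').arr 10 =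
        Function.update (ρ'.arr 10) (l * n + (⟨k, hk⟩ : Fin n))
          (if wm ⟨k, hk⟩ = l then 1 else 0) := by
      simp only [Program.result, Test.eval_eq, cell, Expr.eval, r3, h9, b0, b13]
      split_ifs <;> simp [State.setArr]
    change (Program.result _ ρ').arr 10 (j * n + x) = 1 ↔ _
    rw [hres]
    by_cases hc : j * n + (x : ℕ) = l * n + (⟨k, hk⟩ : Fin n)
    · rw [hc, Function.update_self]
      obtain ⟨rfl, rfl⟩ := cell_eq_iff.1 hc
      simp
    · rw [Function.update_of_ne hc]
      refine hI' x j ?_ hj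
      by_contra hx'
      have hxk : (x : ℕ) = k := by omega
      exact hc (cell_eq_iff.2 ⟨by omega, Fin.ext hxk⟩)
  · intro τ hF hI' x j hx hj
    exact hI' x j (by omega) hj

variable {R : Rooting T (n - 1)} {wm wp : Fin n → ℕ}

theorem runs_search {σ : State} {s : ℕ} (hR : Ready R wm wp σ) (h7 : σ.reg 7 = s)
    (h13 : σ.reg 13 = 0) (hC : Columns n s σ) {P : Fin n → ℕ → Prop} (hT : Table s P σ) :
    Runs search σ (n * (25 + 9) + 7) fun τ =>
      (τ.reg 13 = 0 ∧ ∀ x, P x s → ¬ ∑ y, wp y - R.subWeight wp x ≤ s) ∨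
      (τ.reg 13 = 1 ∧ ∃ x : Fin n, τ.reg 14 = x ∧ P x s ∧ ∑ y, wp y - R.subWeight wp x ≤ s) := by
  refine (Runs.forTo (N := n) (T := 25) (fun k τ =>
      (τ.reg 13 = 0 ∧ ∀ x : Fin n, (x : ℕ) < k → P x s → ¬ ∑ y, wp y - R.subWeight wp x ≤ s) ∨
      (τ.reg 13 = 1 ∧ ∃ x : Fin n, τ.reg 14 = x ∧ P x s ∧ ∑ y, wp y - R.subWeight wp x ≤ s))
      hR.order (.inl ⟨by simpa [State.setReg] using h13, by simp⟩) ?_).mono le_rfl ?_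
  · intro k hk ρ hF h3 hI
    have hR' : Ready R wm wp ρ := hR.of_frame hF
    have r7 : ρ.reg 7 = s := (hF.reg 7).trans h7
    have b13 : ρ.arr 13 s = s * n := by rw [hF.arr 13]; exact hC s le_rfl
    have b10 : ρ.arr 10 (s * n + k) = 1 ↔ P ⟨k, hk⟩ s := by
      rw [hF.arr 10]; exact hT ⟨k, hk⟩ s le_rfl
    have b9 : ρ.arr 9 k = R.subWeight wp ⟨k, hk⟩ := hR'.sub ⟨k, hk⟩
    refine Runs.loopFree ?_
    classical
    simp only [Program.result, Test.eval_and, Test.eval_eq, Test.eval_le, cell, Expr.eval, h3, r7,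
      b13, b9, b10, hR'.total]
    split_ifs with hc
    · exact .inr ⟨by simp [State.setReg], ⟨k, hk⟩, by simp [State.setReg, h3], hc⟩
    · rcases hI with ⟨h13, hI⟩ | ⟨h13, hI⟩
      · refine .inl ⟨by simpa [State.setReg] using h13, fun x hx => ?_⟩
        rcases Nat.lt_succ_iff_lt_or_eq.1 hx with hx | hx
        · exact hI x hx
        · obtain rfl : x = ⟨k, hk⟩ := Fin.ext hx
          exact fun h1 h2 => hc ⟨h1, h2⟩
      · exact .inr ⟨by simpa [State.setReg] using h13, by simpa [State.setReg] using hI⟩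
  · rintro τ - (⟨h, h'⟩ | h)
    · exact .inl ⟨h, fun x => h' x x.2⟩
    · exact .inr h

/-- `c` encodes how the entry for the weight `j` in the row of the parent of the `i`-th vertex
arises when that vertex is merged into its parent: `0` stands for leaving out the vertex, and
`b + 1` for giving it the weight `b`. -/
def Choice (R : Rooting T (n - 1)) (wm wp : Fin n → ℕ) (s i j c : ℕ) : Prop :=
  (c = 0 ∧ R.subWeight wp (R.ord i) ≤ s ∧ R.dp wm wp s i (R.par (R.ord i)) j) ∨
  (1 ≤ c ∧ c - 1 ≤ j ∧ R.dp wm wp s i (R.ord i) (c - 1) ∧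
    R.dp wm wp s i (R.par (R.ord i)) (j - (c - 1)))

theorem dp_succ_par {s i j : ℕ} : R.dp wm wp s (i + 1) (R.par (R.ord i)) j ↔
    (R.subWeight wp (R.ord i) ≤ s ∧ R.dp wm wp s i (R.par (R.ord i)) j) ∨
      ∃ b ≤ j, R.dp wm wp s i (R.ord i) b ∧ R.dp wm wp s i (R.par (R.ord i)) (j - b) := by
  simp [Rooting.dp]

/-- Old entries of the parent's row are assumed only up to `j`: splitting `j` never needs more, and
the larger ones are already overwritten. -/
theorem runs_trySplit {σ : State} {s i j : ℕ} (hj : j ≤ s) (h4 : σ.reg 4 = R.ord i)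
    (h5 : σ.reg 5 = R.par (R.ord i)) (h9 : σ.reg 9 = j) (h16 : σ.reg 16 = j + 1)
    (hC : Columns n s σ)
    (hv : ∀ j ≤ s, σ.arr 10 (j * n + R.ord i) = 1 ↔ R.dp wm wp s i (R.ord i) j)
    (hp : ∀ l ≤ j, σ.arr 10 (l * n + R.par (R.ord i)) = 1 ↔ R.dp wm wp s i (R.par (R.ord i)) l)
    (h11 : σ.reg 11 = 1 ↔
      R.subWeight wp (R.ord i) ≤ s ∧ R.dp wm wp s i (R.par (R.ord i)) j)
    (h12 : σ.reg 12 = 0) :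
    Runs (forTo 10 16 trySplit) σ ((j + 1) * (25 + 9) + 7) fun τ =>
      (τ.reg 11 = 1 ↔ R.dp wm wp s (i + 1) (R.par (R.ord i)) j) ∧
      (τ.reg 11 = 1 → Choice R wm wp s i j (τ.reg 12)) := by
  refine (Runs.forTo (N := j + 1) (T := 25) (fun k τ =>
    (τ.reg 11 = 1 ↔ (R.subWeight wp (R.ord i) ≤ s ∧ R.dp wm wp s i (R.par (R.ord i)) j) ∨
      ∃ b < k, R.dp wm wp s i (R.ord i) b ∧ R.dp wm wp s i (R.par (R.ord i)) (j - b)) ∧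
    (τ.reg 11 = 1 → Choice R wm wp s i j (τ.reg 12))) h16 ?_ ?_).mono le_rfl ?_
  · simp only [State.setReg]
    simp only [Function.update_apply, Nat.reduceEqDiff, if_false, h11, h12]
    simp +contextual [Choice]
  · intro k hk ρ hF h10 ⟨hI1, hI2⟩
    have r4 : ρ.reg 4 = R.ord i := (hF.reg 4).trans h4
    have r5 : ρ.reg 5 = R.par (R.ord i) := (hF.reg 5).trans h5
    have r9 : ρ.reg 9 = j := (hF.reg 9).trans h9
    have b13 : ρ.arr 13 k = k * n := by rw [hF.arr 13]; exact hC k (by omega)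
    have b13' : ρ.arr 13 (j - k) = (j - k) * n := by rw [hF.arr 13]; exact hC _ (by omega)
    have bv := hv k (by omega)
    have bp := hp (j - k) (by omega)
    have a10 : ρ.arr 10 = σ.arr 10 := hF.arr 10
    refine Runs.loopFree ?_
    classical
    simp only [trySplit, Program.result, Test.eval_and, Test.eval_eq, cell, Expr.eval, h10, r4, r5,
      r9, b13, b13', a10, bv, bp]
    split_ifs with hc
    · simp only [State.setReg, Function.update_apply, Nat.reduceEqDiff, if_false, if_true, true_iff,
        forall_const]
      refine ⟨.inr ⟨k, by omega, hc⟩, .inr ⟨by omega, ?_⟩⟩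
      simpa [h10] using ⟨by omega, hc⟩
    · simp only [State.setReg, Function.update_apply, Nat.reduceEqDiff, if_false]
      refine ⟨hI1.trans (or_congr_right ⟨?_, ?_⟩), hI2⟩
      · rintro ⟨b, hb, h⟩
        exact ⟨b, by omega, h⟩
      · rintro ⟨b, hb, h⟩
        rcases Nat.lt_succ_iff_lt_or_eq.1 hb with hb | rfl
        · exact ⟨b, hb, h⟩
        · exact absurd h hc
  · rintro τ - ⟨h1, h2⟩
    refine ⟨h1.trans (Iff.trans ?_ dp_succ_par.symm), h2⟩
    simp only [Nat.lt_succ_iff]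

/-- The parent's row is updated in place, with weights in decreasing order as for the 0-1 knapsack.
The choices go to the child's row of array `11`, which no other merge of the round uses. -/
theorem runs_mergeRow {σ : State} {s i : ℕ} (hi : i < n - 1) (hR : Ready R wm wp σ)
    (h4 : σ.reg 4 = R.ord i) (h5 : σ.reg 5 = R.par (R.ord i)) (h7 : σ.reg 7 = s)
    (h8 : σ.reg 8 = s + 1) (hC : Columns n s σ) (hT : Table s (R.dp wm wp s i) σ) :
    Runs mergeRow σ ((s + 1) * ((s + 1) * (25 + 9) + 43 + 9) + 7) fun τ =>
      Table s (R.dp wm wp s (i + 1)) τ ∧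
      (∀ j ≤ s, R.dp wm wp s (i + 1) (R.par (R.ord i)) j →
        Choice R wm wp s i j (τ.arr 11 (j * n + R.ord i))) ∧
      ∀ x ≠ R.ord i, ∀ j, τ.arr 11 (j * n + x) = σ.arr 11 (j * n + x) := by
  have hvp : R.ord i ≠ R.par (R.ord i) := fun e => by
    have := R.lt_par _ (R.ord_ne_root hi)
    rw [← e] at this
    exact lt_irrefl _ this
  refine (Runs.forTo (N := s + 1) (fun k τ =>
      (∀ (x : Fin n) (j : ℕ), j ≤ s → (τ.arr 10 (j * n + x) = 1 ↔
        if x = R.par (R.ord i) ∧ s + 1 - k ≤ j then R.dp wm wp s (i + 1) x j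
        else R.dp wm wp s i x j)) ∧
      (∀ j ≤ s, s + 1 - k ≤ j → R.dp wm wp s (i + 1) (R.par (R.ord i)) j →
        Choice R wm wp s i j (τ.arr 11 (j * n + R.ord i))) ∧
      ∀ x ≠ R.ord i, ∀ j, τ.arr 11 (j * n + x) = σ.arr 11 (j * n + x)) h8
    (T := (s + 1) * (25 + 9) + 43) ⟨?_, ?_, ?_⟩ ?_).mono le_rfl ?_
  · intro x j hj
    rw [if_neg (by omega)]
    exact hT x j hj
  · intro j hj hj'; omega
  · intro x _ j; rfl
  · intro k hk ρ hF h15 ⟨hI1, hI2, hI3⟩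
    have hR' : Ready R wm wp ρ := hR.of_frame hF
    have r4 : ρ.reg 4 = R.ord i := (hF.reg 4).trans h4
    have r5 : ρ.reg 5 = R.par (R.ord i) := (hF.reg 5).trans h5
    have r7 : ρ.reg 7 = s := (hF.reg 7).trans h7
    have a13 : ∀ j ≤ s, ρ.arr 13 j = j * n := by rw [hF.arr 13]; exact hC
    obtain ⟨j, hjk⟩ : ∃ j, j = s - k := ⟨_, rfl⟩
    have hj : j ≤ s := by omega
    have hold : ∀ (x : Fin n) (l : ℕ), l ≤ s → (x = R.par (R.ord i) → l ≤ j) →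
        (ρ.arr 10 (l * n + x) = 1 ↔ R.dp wm wp s i x l) := by
      intro x l hl hx
      rw [hI1 x l hl, if_neg]
      rintro ⟨h1, h2⟩
      have := hx h1
      omega
    have hstart : Runs startCell ρ 24 fun τ => τ.reg 9 = j ∧ τ.reg 16 = j + 1 ∧
        τ.reg 12 = 0 ∧ (τ.reg 11 = 1 ↔
          R.subWeight wp (R.ord i) ≤ s ∧ R.dp wm wp s i (R.par (R.ord i)) j) := by
      refine Runs.loopFree ?_
      have e := hold (R.par (R.ord i)) j hj fun _ => le_rfl
      rw [← e]
      simp only [startCell, Program.result, Test.eval_le, cell, Expr.eval, State.setReg,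
        Function.update_apply, Nat.reduceEqDiff, if_true, if_false, r4, r5, r7, h15, ← hjk, hR'.sub,
        a13 j hj]
      split_ifs with hc <;> simp [hc]
    refine (Runs.seq hstart (T₂ := ((j + 1) * (25 + 9) + 7) + 12) (Q₂ := fun τ =>
      (∀ (x : Fin n) (l : ℕ), l ≤ s → (τ.arr 10 (l * n + x) = 1 ↔
        if x = R.par (R.ord i) ∧ s + 1 - (k + 1) ≤ l then R.dp wm wp s (i + 1) x l
        else R.dp wm wp s i x l)) ∧
      (∀ l ≤ s, s + 1 - (k + 1) ≤ l → R.dp wm wp s (i + 1) (R.par (R.ord i)) l →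
        Choice R wm wp s i l (τ.arr 11 (l * n + R.ord i))) ∧
      ∀ x ≠ R.ord i, ∀ j, τ.arr 11 (j * n + x) = σ.arr 11 (j * n + x)) ?_).mono ?_
        fun τ _ h => h
    · rintro ρ₁ hF₁ ⟨h9, h16, h12, h11⟩
      have a10 : ρ₁.arr 10 = ρ.arr 10 := hF₁.arr 10
      have a13' : ρ₁.arr 13 = ρ.arr 13 := hF₁.arr 13
      have s4 : ρ₁.reg 4 = R.ord i := (hF₁.reg 4).trans r4
      have s5 : ρ₁.reg 5 = R.par (R.ord i) := (hF₁.reg 5).trans r5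
      refine Runs.seq (runs_trySplit hj s4 s5 h9 h16
        (by rw [Columns, a13']; exact a13)
        (fun l hl => by rw [a10]; exact hold _ l hl fun e => absurd e hvp)
        (fun l hl => by rw [a10]; exact hold _ l (by omega) fun _ => hl) h11 h12) ?_
      rintro ρ₂ hF₂ ⟨g11, g12⟩
      have t4 : ρ₂.reg 4 = R.ord i := (hF₂.reg 4).trans s4
      have t5 : ρ₂.reg 5 = R.par (R.ord i) := (hF₂.reg 5).trans s5
      have t9 : ρ₂.reg 9 = j := (hF₂.reg 9).trans h9
      have b13 : ρ₂.arr 13 j = j * n := by rw [hF₂.arr 13, a13', a13 j hj]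
      have b10 : ρ₂.arr 10 = ρ.arr 10 := (hF₂.arr 10).trans a10
      have b11 : ρ₂.arr 11 = ρ.arr 11 := (hF₂.arr 11).trans (hF₁.arr 11)
      refine (Runs.loopFree (T := 12) (Q := fun τ =>
        τ.arr 10 = Function.update (ρ.arr 10) (j * n + R.par (R.ord i)) (ρ₂.reg 11) ∧
        τ.arr 11 = Function.update (ρ.arr 11) (j * n + R.ord i) (ρ₂.reg 12)) ?_).mono le_rfl ?_
      · simp [writeCell, Program.result, State.setArr, cell, Expr.eval, t4, t5, t9, b13, b10, b11]
      · rintro τ - ⟨e10, e11⟩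
        refine ⟨fun x l hl => ?_, fun l hl hl' hdp => ?_, fun x hx l => ?_⟩
        · rw [e10]
          by_cases hc : l * n + (x : ℕ) = j * n + R.par (R.ord i)
          · rw [hc, Function.update_self]
            obtain ⟨rfl, rfl⟩ := cell_eq_iff.1 hc
            rw [if_pos ⟨rfl, by omega⟩, g11]
          · rw [Function.update_of_ne hc, hI1 x l hl]
            by_cases hx : x = R.par (R.ord i)
            · have hlj : l ≠ j := fun e => hc (cell_eq_iff.2 ⟨e, hx⟩)
              have : s + 1 - k ≤ l ↔ s + 1 - (k + 1) ≤ l := by omega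
              simp only [this]
            · simp only [hx, false_and]
        · rw [e11]
          by_cases hlj : l = j
          · subst hlj
            rw [Function.update_self]
            exact g12 (g11.2 hdp)
          · rw [Function.update_of_ne fun e => hlj (cell_eq_iff.1 e).1]
            exact hI2 l hl (by omega) hdp
        · rw [e11, Function.update_of_ne fun e => hx (cell_eq_iff.1 e).2]
          exact hI3 x hx l
    · have : (j + 1) * (25 + 9) ≤ (s + 1) * (25 + 9) := Nat.mul_le_mul_right _ (by omega)
      omega
  · rintro τ - ⟨h1, h2, h3⟩
    refine ⟨fun x j hj => ?_, fun j hj => h2 j hj (by omega), h3⟩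
    rw [h1 x j hj]
    by_cases hx : x = R.par (R.ord i)
    · rw [if_pos ⟨hx, by omega⟩]
    · rw [if_neg fun h => hx h.1]
      simp [Rooting.dp, hx]

theorem runs_load {σ : State} {i : ℕ} (hi : i < n - 1) (hR : Ready R wm wp σ) (h3 : σ.reg 3 = i) :
    Runs load σ 6 fun τ => τ.reg 4 = R.ord i ∧ τ.reg 5 = R.par (R.ord i) := by
  refine Runs.loopFree ?_
  simp [load, Program.result, State.setReg, Expr.eval, h3, hR.ord i hi]

theorem runs_merge {σ : State} {s : ℕ} (hR : Ready R wm wp σ) (h7 : σ.reg 7 = s)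
    (h8 : σ.reg 8 = s + 1) (hC : Columns n s σ) (hT : Table s (R.dp wm wp s 0) σ) :
    Runs merge σ ((n - 1) * (6 + ((s + 1) * ((s + 1) * (25 + 9) + 43 + 9) + 7) + 9) + 7) fun τ =>
      Table s (R.dp wm wp s (n - 1)) τ ∧
      ∀ i < n - 1, ∀ j ≤ s, R.dp wm wp s (i + 1) (R.par (R.ord i)) j →
        Choice R wm wp s i j (τ.arr 11 (j * n + R.ord i)) := by
  refine (Runs.forTo (N := n - 1) (fun k τ => Table s (R.dp wm wp s k) τ ∧
      ∀ i < k, ∀ j ≤ s, R.dp wm wp s (i + 1) (R.par (R.ord i)) j →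
        Choice R wm wp s i j (τ.arr 11 (j * n + R.ord i))) hR.edges
      ⟨hT, by simp⟩ ?_).mono le_rfl fun τ _ h => h
  intro k hk ρ hF h3 ⟨hI1, hI2⟩
  have hR' : Ready R wm wp ρ := hR.of_frame hF
  refine Runs.seq (runs_load hk hR' h3) ?_
  rintro ρ₁ hF₁ ⟨h4, h5⟩
  have a10 : ρ₁.arr 10 = ρ.arr 10 := hF₁.arr 10
  have a11 : ρ₁.arr 11 = ρ.arr 11 := hF₁.arr 11
  have a13 : ρ₁.arr 13 = σ.arr 13 := (hF₁.arr 13).trans (hF.arr 13)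
  refine (runs_mergeRow hk (hR'.of_frame hF₁) h4 h5 (((hF₁.reg 7).trans (hF.reg 7)).trans h7)
    (((hF₁.reg 8).trans (hF.reg 8)).trans h8) (by rw [Columns, a13]; exact hC)
    (by rw [Table, a10]; exact hI1)).mono le_rfl ?_
  rintro τ - ⟨g1, g2, g3⟩
  refine ⟨g1, fun i hi j hj hdp => ?_⟩
  rcases Nat.lt_succ_iff_lt_or_eq.1 hi with hi | rfl
  · have hne : R.ord i ≠ R.ord k := fun e => by
      have h1 := R.rank_ord i (by omega)
      have h2 := R.rank_ord k hk
      rw [e] at h1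
      omega
    change Choice R wm wp s i j (τ.arr 11 (j * n + R.ord i))
    rw [g3 _ hne, a11]
    exact hI2 i hi j hj hdp
  · exact g2 j hj hdp

/-- The memory after treating the weight `s`. -/
structure Treated (R : Rooting T (n - 1)) (wm wp : Fin n → ℕ) (s : ℕ) (τ : State) : Prop where
  ready : Ready R wm wp τ
  -- One column beyond `s`, as the next round requires.
  columns : Columns n (s + 1) τ
  weight : τ.reg 7 = s
  next : τ.reg 8 = s + 1
  choice : ∀ i < n - 1, ∀ j ≤ s, R.dp wm wp s (i + 1) (R.par (R.ord i)) j →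
    Choice R wm wp s i j (τ.arr 11 (j * n + R.ord i))
  found : (τ.reg 13 = 0 ∧
      ∀ x, R.dp wm wp s (n - 1) x s → ¬ ∑ y, wp y - R.subWeight wp x ≤ s) ∨
    (τ.reg 13 = 1 ∧ ∃ x : Fin n, τ.reg 14 = x ∧ R.dp wm wp s (n - 1) x s ∧
      ∑ y, wp y - R.subWeight wp x ≤ s)

theorem runs_round {σ : State} {s : ℕ} (hn : 0 < n) (hR : Ready R wm wp σ)
    (hC : Columns n s σ) (h8 : σ.reg 8 = s) (h13 : σ.reg 13 = 0) :
    Runs round σ (300 * (n * (s + 1) ^ 2)) (Treated R wm wp s) := by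
  have hnext : Runs nextWeight σ 12 fun τ => τ.reg 7 = s ∧ τ.reg 8 = s + 1 ∧
      Columns n (s + 1) τ := by
    refine Runs.loopFree ⟨?_, ?_, fun j hj => ?_⟩
    · simp [nextWeight, Program.result, State.setReg, State.setArr, Expr.eval, h8]
    · simp [nextWeight, Program.result, State.setReg, State.setArr, Expr.eval, h8]
    · have hres : (nextWeight.result σ).arr 13 =
          Function.update (σ.arr 13) (s + 1) (s * n + n) := by
        simp [nextWeight, Program.result, State.setReg, State.setArr, Expr.eval, h8, hR.order,
          hC s le_rfl]
      rw [hres]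
      by_cases hjs : j = s + 1
      · subst hjs
        rw [Function.update_self]
        ring
      · rw [Function.update_of_ne hjs]
        exact hC j (by omega)
  refine (Runs.seq hnext (T₂ := (n * ((s + 1) * (24 + 9) + 7 + 9) + 7) +
    (((n - 1) * (6 + ((s + 1) * ((s + 1) * (25 + 9) + 43 + 9) + 7) + 9) + 7) +
      (n * (25 + 9) + 7))) (Q₂ := Treated R wm wp s) ?_).mono ?_ fun τ _ h => h
  · rintro ρ₁ hF₁ ⟨h7, h8, hC₁⟩
    have hR₁ : Ready R wm wp ρ₁ := hR.of_frame hF₁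
    have hC₁' : Columns n s ρ₁ := fun j hj => hC₁ j (by omega)
    refine Runs.seq (runs_initTable hR₁.order h8 hR₁.weight hC₁') ?_
    intro ρ₂ hF₂ hT₂
    have hR₂ : Ready R wm wp ρ₂ := hR₁.of_frame hF₂
    have a13 : ρ₂.arr 13 = ρ₁.arr 13 := hF₂.arr 13
    refine Runs.seq (runs_merge hR₂ ((hF₂.reg 7).trans h7) ((hF₂.reg 8).trans h8)
      (by rw [Columns, a13]; exact hC₁') hT₂) ?_
    rintro ρ₃ hF₃ ⟨hT₃, hch⟩
    have hR₃ : Ready R wm wp ρ₃ := hR₂.of_frame hF₃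
    have b13 : ρ₃.arr 13 = ρ₁.arr 13 := (hF₃.arr 13).trans a13
    have r7 : ρ₃.reg 7 = s := ((hF₃.reg 7).trans (hF₂.reg 7)).trans h7
    have r8 : ρ₃.reg 8 = s + 1 := ((hF₃.reg 8).trans (hF₂.reg 8)).trans h8
    have r13 : ρ₃.reg 13 = 0 :=
      (((hF₃.reg 13).trans (hF₂.reg 13)).trans (hF₁.reg 13)).trans h13
    refine (runs_search hR₃ r7 r13 (by rw [Columns, b13]; exact hC₁') hT₃).mono le_rfl ?_
    intro τ hF hf
    refine ⟨hR₃.of_frame hF, ?_, (hF.reg 7).trans r7, (hF.reg 8).trans r8, ?_, hf⟩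
    · rw [Columns, hF.arr 13, b13]; exact hC₁
    · rw [hF.arr 11]; exact hch
  · obtain ⟨m, rfl⟩ : ∃ m, n = m + 1 := ⟨n - 1, by omega⟩
    simp only [Nat.add_sub_cancel]
    ring_nf
    nlinarith [Nat.zero_le (m * s ^ 2), Nat.zero_le (m * s), Nat.zero_le (s ^ 2)]

/-! ### Reconstruction from the recorded choices. -/

theorem runs_undo {σ : State} {s i : ℕ} {u : Fin n} (hi : i < n - 1) (hR : Ready R wm wp σ)
    (hC : Columns n s σ)
    (hch : ∀ j ≤ s, R.dp wm wp s (i + 1) (R.par (R.ord i)) j →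
      Choice R wm wp s i j (σ.arr 11 (j * n + R.ord i)))
    (hk : n - 1 - 1 - σ.reg 15 = i) {S : Finset (Fin n)} (hS : ∀ x : Fin n, σ.arr 4 x = 1 ↔ x ∈ S)
    (h : R.Recon wm wp s u (i + 1) S fun x => σ.arr 12 x) :
    Runs undo σ 46 fun τ => ∃ S : Finset (Fin n), (∀ x : Fin n, τ.arr 4 x = 1 ↔ x ∈ S) ∧
      R.Recon wm wp s u i S fun x => τ.arr 12 x := by
  obtain ⟨e7, e8⟩ := hR.ord i hi
  refine Runs.loopFree ?_
  by_cases hp : R.par (R.ord i) ∈ S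
  · have hp' := (hS _).2 hp
    have hle := h.rem_le hp
    have hb13 := hC _ hle
    have hc := hch _ hle (h.dp _ hp)
    obtain ⟨c, hceq⟩ : ∃ c, c = σ.arr 11 (σ.arr 12 (R.par (R.ord i)) * n + R.ord i) := ⟨_, rfl⟩
    rw [← hceq] at hc
    have hvp : (R.ord i : ℕ) ≠ R.par (R.ord i) := fun e =>
      h.ord_not_mem hi hp (by rw [Fin.ext e]; exact hp)
    rcases hc with ⟨hc0, hsub, hdp⟩ | ⟨hc1, hcj, hdv, hdp⟩
    · have hres : (undo.result σ).arr = σ.arr := by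
        simp [undo, load, cell, Program.result, Test.eval_eq, Test.eval_le, Expr.eval, State.setReg,
          hR.edges, hk, e7, e8, hp', hb13, ← hceq, hc0]
      rw [hres]
      exact ⟨S, hS, h.step_exclude fun _ => ⟨hsub, hdp⟩⟩
    · have hres : (undo.result σ).arr = (((σ.setArr 4 (R.ord i) 1).setArr 12 (R.ord i)
          (c - 1)).setArr 12 (R.par (R.ord i)) (σ.arr 12 (R.par (R.ord i)) - (c - 1))).arr := by
        simp [undo, load, cell, Program.result, Test.eval_eq, Test.eval_le, Expr.eval, State.setReg,
          State.setArr, hR.edges, hk, e7, e8, hp', hb13, ← hceq, hc1, hvp.symm]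
      rw [hres]
      refine ⟨insert (R.ord i) S, fun x => ?_, ?_⟩
      · by_cases hx : x = R.ord i
        · subst hx; simp [State.setArr]
        · have hx' : (x : ℕ) ≠ R.ord i := fun e => hx (Fin.ext e)
          simp [State.setArr, hx, hx', hS]
      · have := h.step_include hi hp hcj hdv hdp
        convert this using 1
        ext x
        simp [State.setArr, Function.update_apply, Fin.ext_iff]
  · have hres : (undo.result σ).arr = σ.arr := by
      simp [undo, load, cell, Program.result, Test.eval_eq, Expr.eval, State.setReg,
        hR.edges, hk, e7, e8, hS, hp]
    rw [hres]
    exact ⟨S, hS, h.step_exclude fun h => absurd h hp⟩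

theorem runs_reconstruct {σ : State} {s : ℕ} {u : Fin n} (hR : Treated R wm wp s σ)
    (h4 : ∀ x : Fin n, σ.arr 4 x = 0) (hu : σ.reg 14 = u) (hdp : R.dp wm wp s (n - 1) u s) :
    Runs reconstruct σ (100 * n) fun τ => ∃ S : Finset (Fin n),
      (∀ x : Fin n, τ.arr 4 x = 1 ↔ x ∈ S) ∧ R.Recon wm wp s u 0 S fun x => τ.arr 12 x := by
  have hA : Runs (.seq (.store 4 (.reg 14) (.lit 1)) (.store 12 (.reg 14) (.reg 7))) σ 6
      fun τ => τ.arr 4 = Function.update (σ.arr 4) u 1 ∧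
        τ.arr 12 = Function.update (σ.arr 12) u s := by
    refine Runs.loopFree ?_
    simp [Program.result, State.setArr, Expr.eval, hu, hR.weight]
  refine (Runs.seq hA (T₂ := (n - 1) * (46 + 9) + 7) (Q₂ := fun τ => ∃ S : Finset (Fin n),
      (∀ x : Fin n, τ.arr 4 x = 1 ↔ x ∈ S) ∧ R.Recon wm wp s u 0 S fun x => τ.arr 12 x)
      ?_).mono (by have := u.pos; omega) fun _ _ h => h
  rintro ρ₁ hF₁ ⟨a4, a12⟩
  have hR₁ : Ready R wm wp ρ₁ := hR.ready.of_frame hF₁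
  refine (Runs.forTo (N := n - 1) (fun k τ => ∃ S : Finset (Fin n),
      (∀ x : Fin n, τ.arr 4 x = 1 ↔ x ∈ S) ∧
      R.Recon wm wp s u (n - 1 - k) S fun x => τ.arr 12 x) hR₁.edges ⟨{u}, ?_, ?_⟩ ?_).mono le_rfl ?_
  · intro x
    change ρ₁.arr 4 x = 1 ↔ _
    rw [a4]
    by_cases hx : x = u
    · subst hx; simp
    · rw [Function.update_of_ne fun e => hx (Fin.ext e)]
      simp [h4, hx]
  · refine Rooting.Recon.start hdp ?_
    change ρ₁.arr 12 u = s
    rw [a12, Function.update_self]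
  · rintro k hk ρ hF h15 ⟨S, hS, hrec⟩
    have e : n - 1 - k = n - 1 - (k + 1) + 1 := by omega
    have a13 : ρ.arr 13 = σ.arr 13 := (hF.arr 13).trans (hF₁.arr 13)
    have a11 : ρ.arr 11 = σ.arr 11 := (hF.arr 11).trans (hF₁.arr 11)
    refine runs_undo (by omega) (hR₁.of_frame hF) ?_ ?_ (by omega) hS (e ▸ hrec)
    · rw [Columns, a13]
      exact fun j hj => hR.columns j (by omega)
    · rw [a11]
      exact hR.choice _ (by omega)
  · rintro τ - ⟨S, hS, hrec⟩
    exact ⟨S, hS, by simpa using hrec⟩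

/-! ### Search for the least weight, and the whole program. -/

theorem above_iff (R : Rooting T (n - 1)) (wp : Fin n → ℕ) (u : Fin n) (s : ℕ) :
    ∑ y, wp y - R.subWeight wp u ≤ s ↔ setWeight wp {y | ¬ R.Desc u y} ≤ s := by
  have h := setWeight_add_compl wp {y | R.Desc u y}
  have e : {y | R.Desc u y}ᶜ = {y | ¬ R.Desc u y} := rfl
  rw [e] at h
  rw [← h, Rooting.subWeight, Nat.add_sub_cancel_left]

/-- While nothing is found, `reg 8` is a lower bound for the weight of every connected safe set. The
set promised by `hW` then keeps `reg 8` at most `W`, which bounds both the number of rounds and the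
cost of each. -/
theorem runs_search_loop {σ : State} {W : ℕ} (hn : 0 < n) (hR : Ready R wm wp σ)
    (h8 : σ.reg 8 = 0) (h13 : σ.reg 13 = 0) (hC : σ.arr 13 0 = 0)
    (hW : ∃ S : Set (Fin n), IsConnectedSafeSet T wm wp S ∧ setWeight wm S ≤ W) :
    Runs (.loop (.eq (.reg 13) (.lit 0)) round) σ ((W + 1) * (4 + 300 * (n * (W + 1) ^ 2)) + 4)
      fun τ => ∃ s u, Treated R wm wp s τ ∧
        (∀ S : Set (Fin n), IsConnectedSafeSet T wm wp S → s ≤ setWeight wm S) ∧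
        τ.reg 14 = (u : Fin n) ∧ R.dp wm wp s (n - 1) u s ∧
        setWeight wp {y | ¬ R.Desc u y} ≤ s := by
  refine (Runs.loop (μ := fun ρ => W + 1 - ρ.reg 8) (T := 300 * (n * (W + 1) ^ 2))
    (I := fun ρ =>
      (ρ.reg 13 = 0 ∧ Ready R wm wp ρ ∧ Columns n (ρ.reg 8) ρ ∧
        ∀ S : Set (Fin n), IsConnectedSafeSet T wm wp S → ρ.reg 8 ≤ setWeight wm S) ∨
      (ρ.reg 13 = 1 ∧ ∃ s u, Treated R wm wp s ρ ∧
        (∀ S : Set (Fin n), IsConnectedSafeSet T wm wp S → s ≤ setWeight wm S) ∧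
        ρ.reg 14 = (u : Fin n) ∧ R.dp wm wp s (n - 1) u s ∧
        setWeight wp {y | ¬ R.Desc u y} ≤ s)) ?_ (.inl ⟨h13, hR, ?_, ?_⟩)).mono ?_ ?_
  · rintro ρ hI hb
    simp only [Test.eval_eq, Expr.eval] at hb
    rcases hI with ⟨-, hR, hC, hmin⟩ | ⟨h, -⟩
    · obtain ⟨S₀, hS₀, hS₀W⟩ := hW
      have hle : ρ.reg 8 ≤ W := (hmin S₀ hS₀).trans hS₀W
      refine (runs_round hn hR hC rfl hb).mono ?_ ?_
      · gcongr
      · intro τ _ hτ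
        refine ⟨?_, by rw [hτ.next]; omega⟩
        rcases hτ.found with ⟨hf, hno⟩ | ⟨hf, u, hu, hdp, hab⟩
        · refine .inl ⟨hf, hτ.ready, by rw [hτ.next]; exact hτ.columns, fun S hS => ?_⟩
          rw [hτ.next]
          -- A safe set of weight exactly `reg 8` would have produced a table entry that the search
          -- accepts.
          refine Nat.lt_of_le_of_ne (hmin S hS) fun e => ?_
          obtain ⟨u, hu⟩ := R.exists_isLocallySafe hS
          rw [← e] at hu
          exact hno u (hu.dp_weight R e.symm) ((above_iff R wp u _).2 hu.above)
        · exact .inr ⟨hf, _, u, hτ, hmin, hu, hdp, (above_iff R wp u _).1 hab⟩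
    · omega
  · rw [h8]
    intro j hj
    obtain rfl : j = 0 := by omega
    rw [hC, Nat.zero_mul]
  · intro S _
    rw [h8]
    exact Nat.zero_le _
  · simp [h8, Test.cost, Expr.cost]
  · rintro τ - ⟨hI, hb⟩
    simp only [Test.eval_eq, Expr.eval] at hb
    rcases hI with ⟨h, -⟩ | ⟨-, h⟩
    · exact absurd h hb
    · exact h

theorem runs_main (hT : T.IsTree) {E : List (Fin n × Fin n)} (hE : ListsEdges T E)
    (wm wp : Fin n → ℕ) {W : ℕ}
    (hW : ∃ S : Set (Fin n), IsConnectedSafeSet T wm wp S ∧ setWeight wm S ≤ W) :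
    Runs main (inputState n E wm wp)
      (450 * n + ((W + 1) * (4 + 300 * (n * (W + 1) ^ 2)) + 4))
      fun τ => IsMinConnectedSafeSet T wm wp (outputSet n τ) := by
  classical
  obtain ⟨r⟩ := hT.connected.nonempty
  have hn : 0 < n := r.pos
  refine (Runs.seq (runs_degrees hT hE wm wp) (T₂ := 200 * n + (100 * n +
    (((W + 1) * (4 + 300 * (n * (W + 1) ^ 2)) + 4) + 100 * n)))
    (Q₂ := fun τ => IsMinConnectedSafeSet T wm wp (outputSet n τ)) ?_).mono (by omega)
    fun _ _ h => h
  rintro ρ₁ hF₁ ⟨h1, hdeg⟩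
  have r0 : ρ₁.reg 0 = n := (hF₁.reg 0).trans (by simp [inputState])
  refine Runs.seq (runs_strip hT r0 hdeg) ?_
  rintro ρ₂ hF₂ ⟨R, hord⟩
  refine Runs.seq (runs_subWeights R (wm := wm) (wp := wp) hn ((hF₂.reg 0).trans r0)
    ((hF₂.reg 1).trans h1) ?_ ?_ hord) ?_
  · intro x
    rw [hF₂.arr 0, hF₁.arr 0]
    simp [inputState]
  · intro x
    rw [hF₂.arr 1, hF₁.arr 1]
    simp [inputState]
  intro ρ₃ hF₃ hR
  refine Runs.seq (runs_search_loop hn hR ?_ ?_ ?_ hW) ?_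
  · rw [hF₃.reg 8, hF₂.reg 8, hF₁.reg 8]; simp [inputState]
  · rw [hF₃.reg 13, hF₂.reg 13, hF₁.reg 13]; simp [inputState]
  · rw [hF₃.arr 13, hF₂.arr 13, hF₁.arr 13]; simp [inputState]
  rintro ρ₄ hF₄ ⟨s, u, htr, hmin, hu, hdp, hab⟩
  refine (runs_reconstruct htr (fun x => ?_) hu hdp).mono le_rfl ?_
  · rw [hF₄.arr 4, hF₃.arr 4, hF₂.arr 4, hF₁.arr 4]; simp [inputState]
  · rintro τ - ⟨S, hS, hrec⟩
    have hout : outputSet n τ = (S : Set (Fin n)) := by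
      ext x
      exact hS x
    have hw := hrec.setWeight_eq
    have hsafe := hrec.isLocallySafe hab
    rw [hout]
    refine ⟨Rooting.IsLocallySafe.isConnectedSafeSet R (by rwa [hw]), fun S' hS' => ?_⟩
    rw [hw]
    exact hmin S' hS'

end SafeSetProgram

theorem theorem2 :
    ∃ (P : RAM.Program) (c : ℕ),
      ∀ (n : ℕ) (T : SimpleGraph (Fin n)), T.IsTree →
      ∀ (wm wp : Fin n → ℕ) (E : List (Fin n × Fin n)), ListsEdges T E →
      ∀ W : ℕ, 1 ≤ W →
        (∃ S : Set (Fin n), IsConnectedSafeSet T wm wp S ∧ setWeight wm S ≤ W) →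
        ∃ (τ : RAM.State) (t : ℕ),
          RAM.Exec P (inputState n E wm wp) τ t ∧
          t ≤ c * (n * W ^ 4) ∧
          IsMinConnectedSafeSet T wm wp (outputSet n τ) := by
  -- Since `W + 1 ≤ 2 * W`, the cubic term contributes `300 * 8`; with `450` for the linear phases
  -- and `12` for the rest, the sum is below `3000`.
  refine ⟨SafeSetProgram.main, 3000, fun n T hT wm wp E hE W hW hS => ?_⟩
  obtain ⟨r⟩ := hT.connected.nonempty
  have hn : 1 ≤ n := r.pos
  obtain ⟨τ, t, he, ht, hq⟩ := SafeSetProgram.runs_main hT hE wm wp hS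
  refine ⟨τ, t, he, ht.trans ?_, hq⟩
  have h1 : n ≤ n * W ^ 4 := Nat.le_mul_of_pos_right n (by positivity)
  have h2 : W ^ 3 ≤ W ^ 4 := Nat.pow_le_pow_right hW (by omega)
  have h3 : W ≤ W ^ 4 := Nat.le_self_pow (by omega) W
  have h4 : (W + 1) ^ 3 ≤ 8 * W ^ 3 := by
    calc (W + 1) ^ 3 ≤ (2 * W) ^ 3 := Nat.pow_le_pow_left (by omega) 3
      _ = 8 * W ^ 3 := by ring
  have h5 : n * (W + 1) ^ 3 ≤ 8 * (n * W ^ 4) := by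
    calc n * (W + 1) ^ 3 ≤ n * (8 * W ^ 4) := Nat.mul_le_mul_left n (by omega)
      _ = 8 * (n * W ^ 4) := by ring
  have h6 : W ≤ n * W ^ 4 := h3.trans (Nat.le_mul_of_pos_left _ hn)
  have h7 : (W + 1) * (4 + 300 * (n * (W + 1) ^ 2)) = 4 * W + 4 + 300 * (n * (W + 1) ^ 3) := by
    ring
  omega
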